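/- Let $\Bbbk$ be an algebraically closed field and $R=\Bbbk[x_0,x_1,x_2]$. A finite set $\mathbb X\subseteq\mathbb P^2=\mathbb P^2_\Bbbk$ is called a $\Bbbk$-configuration of type $(d_1,\dots,d_s)$, where $s\ge 1$ and $1\le d_1<\cdots<d_s$ are integers, if there are subsets $\mathbb X_1,\dots,\mathbb X_s$ of $\mathbb X$ and distinct lines $\mathbb L_1,\dots,\mathbb L_s\subseteq\mathbb P^2$ such that (1) $\mathbb X=\bigcup_{i=1}^s\mathbb X_i$; (2) $|\mathbb X_i|=d_i$ and $\mathbb X_i\subseteq\mathbb L_i$ for $i=1,\dots,s$; and (3) for $1<i\le s$ the line $\mathbb L_i$ contains no point of $\mathbb X_j$ for any $1\le j<i$. For an integer $m\geq 1$ let $I_{m\mathbb X}=\bigcap_{P\in\mathbb X}I_P^m$, where $I_P\subseteq R$ is the homogeneous ideal of the point $P$; let $H_{m\mathbb X}(t)=\dim_\Bbbk R_t-\dim_\Bbbk (I_{m\mathbb X})_t$ for $t\ge 0$ and $H_{m\mathbb X}(-1)=0$; and let $\Delta H_{m\mathbb X}(t)=H_{m\mathbb X}(t)-H_{m\mathbb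 X}(t-1)$ for $t\ge 0$. Let $\mathbb X\subseteq\mathbb P^2$ be a $\Bbbk$-configuration of type $(d_1,\dots,d_s)\neq(1)$ and let $m\ge s+1$. Then the number of lines of $\mathbb P^2$ containing exactly $d_s$ points of $\mathbb X$ is finite and equals the last nonzero value of $\Delta H_{m\mathbb X}$; that is, there is an integer $t\ge 0$ such that $\Delta H_{m\mathbb X}(t)\neq 0$, $\Delta H_{m\mathbb X}(u)=0$ for all $u>t$, and $\Delta H_{m\mathbb X}(t)$ is the number of lines containing exactly $d_s$ points of $\mathbb X$. -/

import Mathlib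

open scoped LinearAlgebra.Projectivization

noncomputable section

namespace KConf

/-- The projective plane over `K`. -/
abbrev Plane (K : Type*) [Field K] := ℙ K (Fin 3 → K)

/-- A line of the projective plane, given by a two-dimensional linear subspace of `K³`. -/
abbrev Line (K : Type*) [Field K] :=
  {L : Submodule K (Fin 3 → K) // Module.finrank K L = 2}

/-- The set of points of the projective plane that lie on the line `L`. -/
def Line.points {K : Type*} [Field K] (L : Line K) : Set (Plane K) :=
  {P | P.submodule ≤ L.1}

/-- `X` is a `𝕜`-configuration of type `d = (d₁, …, dₛ)`; the indices `1, …, s` are the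
elements of `Fin s` in increasing order. -/
def IsKConfiguration {K : Type*} [Field K] (X : Finset (Plane K)) {s : ℕ}
    (d : Fin s → ℕ) : Prop :=
  (∀ i, 1 ≤ d i) ∧ StrictMono d ∧
    ∃ (Y : Fin s → Finset (Plane K)) (L : Fin s → Line K),
      Function.Injective L ∧
      (X : Set (Plane K)) = ⋃ i, (Y i : Set (Plane K)) ∧
      (∀ i, (Y i).card = d i ∧ (Y i : Set (Plane K)) ⊆ (L i).points) ∧
      (∀ i j, j < i → ∀ P ∈ Y j, P ∉ (L i).points)

/-- The homogeneous ideal of a point `P` in `K[x₀, x₁, x₂]`, generated by the homogeneous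
polynomials vanishing at `P` (for these, vanishing does not depend on the representative). -/
def pointIdeal {K : Type*} [Field K] (P : Plane K) : Ideal (MvPolynomial (Fin 3) K) :=
  Ideal.span {f | (∃ n, f.IsHomogeneous n) ∧ MvPolynomial.eval P.rep f = 0}

/-- The ideal of the homogeneous fat point scheme `mX`, the intersection of the ideals
`I_P ^ m` for `P ∈ X`. -/
def fatIdeal {K : Type*} [Field K] (m : ℕ) (X : Finset (Plane K)) :
    Ideal (MvPolynomial (Fin 3) K) :=
  ⨅ P ∈ X, pointIdeal P ^ m

/-- The degree `t` component of an ideal, as a space of homogeneous polynomials. -/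
def gradedPart {K : Type*} [Field K] (I : Ideal (MvPolynomial (Fin 3) K)) (t : ℕ) :
    Submodule K (MvPolynomial (Fin 3) K) :=
  MvPolynomial.homogeneousSubmodule (Fin 3) K t ⊓ I.restrictScalars K

/-- The Hilbert function `t ↦ dim R_t - dim I_t` of `R / I`, with values in `ℤ`. -/
def hilbertFunction {K : Type*} [Field K] (I : Ideal (MvPolynomial (Fin 3) K)) (t : ℕ) : ℤ :=
  (Module.finrank K (MvPolynomial.homogeneousSubmodule (Fin 3) K t) : ℤ) -
    (Module.finrank K (gradedPart I t) : ℤ)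

/-- The first difference of `H`, with the convention `H (-1) = 0`. -/
def firstDifference (H : ℕ → ℤ) : ℕ → ℤ
  | 0 => H 0
  | t + 1 => H (t + 1) - H t

/-- `f` has a last nonzero value, and this value is `v`. -/
def IsLastNonzeroValue (f : ℕ → ℤ) (v : ℤ) : Prop :=
  ∃ t, f t = v ∧ v ≠ 0 ∧ ∀ u, t < u → f u = 0

/-- The set of all lines that contain exactly `n` points of `X`. -/
def linesWithExactly {K : Type*} [Field K] (X : Finset (Plane K)) (n : ℕ) : Set (Line K) :=
  {L | ((X : Set (Plane K)) ∩ L.points).ncard = n}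

end KConf

end

namespace KConf

open scoped LinearAlgebra.Projectivization Pointwise
open MvPolynomial

variable {K : Type*} [Field K]

/-! Call a line full if it contains `d_s` points of `X`, and let `r` be the number of full lines.
The last nonzero value of the first difference occurs in degree `m * d_s - 1`. Let `defect X μ n` be
the degree of the fat point scheme minus its Hilbert function in degree `n - 1`. It is nonnegative,
and the first difference at `t` is `defect t - defect (t + 1)`. So the claim is that the defect
vanishes from `m * d_s` on (`ConfigData.defect_nonpos`) and equals `r` at `m * d_s - 1`.

The engine is residuation along a line. Forms of degree `t` in the ideal that vanish on the line are
its equation times forms of degree `t - 1` for the multiplicities lowered by one along it. The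
others restrict to forms in two variables with `e` prescribed zeros, `e` being the sum of the
multiplicities on the line. If `e ≤ t + 1`, the defect is bounded by that of the residual scheme one
degree lower (`defect_succ_le`). If `e = t + 2`, every restriction is zero and the defect is exactly
one more than the residual one (`defect_succ_eq`).

Two full lines always meet in a point of `X` (`ConfigData.card_inter_full`). Hence, starting from `m
* d_s - 1`, each full line peeled off finds exactly one condition too many, and together they
contribute `r` (`ConfigData.defect_eq_of_full`). It remains to see that what is left has defect
zero. If `d_s > s`, the full lines are among the `L i`; peeling the other `L i` brings all
multiplicities down to `m - 1`, in a degree covered by `defect_nonpos`. If `d_s = s`, the type is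
`(1, 2, …, s)` and one further full line may exist. After normalizing the first line
(`exists_staircaseData`), there are `s + 1` candidates, and a peeling in which every point is met at
least twice ends at multiplicities at most `m - 2` and index `(m - 2) * s`
(`StaircaseData.exists_full`). -/

/-! ### Homogeneous polynomials and linear forms -/

/-- Scaling the arguments of a homogeneous polynomial scales its value. -/
theorem aeval_mul_left_of_isHomogeneous {A : Type*} [CommRing A] [Algebra K A]
    {f : MvPolynomial (Fin 3) K} {n : ℕ} (hf : f.IsHomogeneous n) (c : A) (g : Fin 3 → A) :
    aeval (fun i => c * g i) f = c ^ n * aeval g f := by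
  rw [aeval_def, aeval_def, eval₂_eq', eval₂_eq', Finset.mul_sum]
  refine Finset.sum_congr rfl fun d hd => ?_
  have hdeg : ∑ i, d i = n := by
    rw [← Finsupp.degree_eq_sum]
    exact (hf.degree_eq_sum_deg_support hd).symm
  rw [← hdeg, ← Finset.prod_pow_eq_pow_sum]
  simp only [mul_pow, Finset.prod_mul_distrib]
  ring

theorem eval_smul_of_isHomogeneous {f : MvPolynomial (Fin 3) K} {n : ℕ}
    (hf : f.IsHomogeneous n) (c : K) (x : Fin 3 → K) :
    eval (c • x) f = c ^ n * eval x f := by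
  have := aeval_mul_left_of_isHomogeneous hf c x
  simpa [aeval_eq_eval, Pi.smul_def] using this

/-- The linear form with coefficients `c`. -/
noncomputable def linForm (c : Fin 3 → K) : MvPolynomial (Fin 3) K := ∑ i, C (c i) * X i

theorem linForm_isHomogeneous (c : Fin 3 → K) : (linForm c).IsHomogeneous 1 :=
  IsHomogeneous.sum _ _ _ fun _ _ => isHomogeneous_C_mul_X _ _

@[simp]
theorem eval_linForm (c x : Fin 3 → K) : eval x (linForm c) = ∑ i, c i * x i := by
  simp [linForm]

theorem linForm_ne_zero {c : Fin 3 → K} (hc : c ≠ 0) : linForm c ≠ 0 := by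
  intro h
  apply hc
  ext i
  have := congrArg (eval (Pi.single i 1)) h
  simpa [Pi.single_apply] using this

/-! ### Multiplicity at a point as an order of vanishing -/

theorem mem_pointIdeal_of_eval_eq_zero {P : Plane K} {f : MvPolynomial (Fin 3) K} {n : ℕ}
    (hf : f.IsHomogeneous n) (h : eval P.rep f = 0) : f ∈ pointIdeal P :=
  Ideal.subset_span ⟨⟨n, hf⟩, h⟩

theorem exists_rep_apply_ne_zero (P : Plane K) : ∃ j, P.rep j ≠ 0 := by
  by_contra! h
  exact P.rep_nonzero (funext h)

/-- An index of a nonzero coordinate of `P`. -/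
noncomputable def pivot (P : Plane K) : Fin 3 := (exists_rep_apply_ne_zero P).choose

theorem rep_pivot_ne_zero (P : Plane K) : P.rep (pivot P) ≠ 0 :=
  (exists_rep_apply_ne_zero P).choose_spec

/-- A linear form taking the value `1` at the representative of `P`. -/
noncomputable def unitForm (P : Plane K) : MvPolynomial (Fin 3) K :=
  C (P.rep (pivot P))⁻¹ * X (pivot P)

/-- The linear forms vanishing at `P` obtained by projecting the coordinates along `P`. -/
noncomputable def normalForm (P : Plane K) (i : Fin 3) : MvPolynomial (Fin 3) K :=
  X i - C (P.rep i) * unitForm P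

theorem unitForm_isHomogeneous (P : Plane K) : (unitForm P).IsHomogeneous 1 :=
  isHomogeneous_C_mul_X _ _

theorem normalForm_isHomogeneous (P : Plane K) (i : Fin 3) :
    (normalForm P i).IsHomogeneous 1 :=
  (isHomogeneous_X _ _).sub ((unitForm_isHomogeneous P).C_mul _)

theorem eval_unitForm (P : Plane K) : eval P.rep (unitForm P) = 1 := by
  simp [unitForm, rep_pivot_ne_zero]

theorem normalForm_mem (P : Plane K) (i : Fin 3) : normalForm P i ∈ pointIdeal P :=
  mem_pointIdeal_of_eval_eq_zero (normalForm_isHomogeneous P i)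
    (by simp [normalForm, eval_unitForm])

theorem normalForm_pivot (P : Plane K) : normalForm P (pivot P) = 0 := by
  have h := rep_pivot_ne_zero P
  rw [normalForm, unitForm, ← mul_assoc, ← C_mul, mul_inv_cancel₀ h]
  simp

/-- The substitution contracting the plane towards `P`; the order of vanishing of the parameter
is the multiplicity at `P`. -/
noncomputable def contraction (P : Plane K) :
    MvPolynomial (Fin 3) K →ₐ[K] Polynomial (MvPolynomial (Fin 3) K) :=
  aeval fun i => Polynomial.C (C (P.rep i) * unitForm P) +
    Polynomial.X * Polynomial.C (normalForm P i)

theorem eval_one_contraction (P : Plane K) (f : MvPolynomial (Fin 3) K) :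
    (contraction P f).eval 1 = f := by
  have : ((Polynomial.aeval (R := MvPolynomial (Fin 3) K)
      (1 : MvPolynomial (Fin 3) K)).restrictScalars K).comp (contraction P) = AlgHom.id K _ := by
    ext i : 1
    simp [contraction, normalForm]
  simpa [Polynomial.aeval_def] using congrArg (fun φ => φ f) this

theorem coeff_zero_contraction (P : Plane K) (f : MvPolynomial (Fin 3) K) :
    (contraction P f).coeff 0 = aeval (fun i => unitForm P * C (P.rep i)) f := by
  have : ((Polynomial.aeval (R := MvPolynomial (Fin 3) K)
      (0 : MvPolynomial (Fin 3) K)).restrictScalars K).comp (contraction P) =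
      aeval (fun i => unitForm P * C (P.rep i)) := by
    ext i : 1
    simp [contraction, mul_comm (unitForm P)]
  simpa [Polynomial.aeval_def, Polynomial.coeff_zero_eq_eval_zero]
    using congrArg (fun φ => φ f) this

/-- The Rees algebra is a ring, so it suffices to look at the images of constants and variables; a
variable goes to a constant term plus the parameter times a `normalForm`. -/
theorem contraction_coeff_mem (P : Plane K) (f : MvPolynomial (Fin 3) K) (k : ℕ) :
    (contraction P f).coeff k ∈ pointIdeal P ^ k := by
  have : contraction P f ∈ reesAlgebra (pointIdeal P) := by
    induction f using MvPolynomial.induction_on with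
    | C a =>
      rw [contraction, aeval_C]
      exact Subalgebra.algebraMap_mem (reesAlgebra (pointIdeal P)) (C a)
    | add f g hf hg => rw [map_add]; exact add_mem hf hg
    | mul_X f i hf =>
      rw [map_mul]
      refine mul_mem hf ?_
      rw [contraction, aeval_X]
      refine add_mem (Subalgebra.algebraMap_mem (reesAlgebra (pointIdeal P)) _) ?_
      rw [mul_comm, ← Polynomial.monomial_one_one_eq_X, Polynomial.C_mul_monomial, mul_one,
        reesAlgebra.monomial_mem, pow_one]
      exact normalForm_mem P i
  exact this k

/-- The contraction carries the point ideal into the ideal of the parameter; conversely, setting the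
parameter to `1` writes `f` as the sum of its coefficients, the `k`-th of which lies in the `k`-th
power. Since the parameter is prime, factors can then be cancelled from membership in a power. -/
theorem mem_pointIdeal_pow_iff (P : Plane K) (f : MvPolynomial (Fin 3) K) (m : ℕ) :
    f ∈ pointIdeal P ^ m ↔ Polynomial.X ^ m ∣ contraction P f := by
  constructor
  · intro hf
    have h1 : (pointIdeal P).map (contraction P) ≤ Ideal.span {Polynomial.X} := by
      rw [pointIdeal, Ideal.map_span, Ideal.span_le]
      rintro _ ⟨g, ⟨⟨n, hg⟩, h0⟩, rfl⟩
      rw [SetLike.mem_coe, Ideal.mem_span_singleton, Polynomial.X_dvd_iff,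
        coeff_zero_contraction, aeval_mul_left_of_isHomogeneous hg]
      have : aeval (fun i => (C (P.rep i) : MvPolynomial (Fin 3) K)) g = C (eval P.rep g) := by
        have := congrArg (fun φ => φ g) (show
          (aeval (fun i => (C (P.rep i) : MvPolynomial (Fin 3) K))) =
          (Algebra.ofId K (MvPolynomial (Fin 3) K)).comp (aeval P.rep) by
            ext i : 1
            simp [Algebra.ofId_apply])
        simpa [Algebra.ofId_apply, aeval_eq_eval] using this
      rw [this, h0]
      simp
    have h2 : contraction P f ∈ ((pointIdeal P) ^ m).map (contraction P) :=
      Ideal.mem_map_of_mem _ hf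
    rw [Ideal.map_pow] at h2
    have h3 := Ideal.pow_right_mono h1 m h2
    rwa [Ideal.span_singleton_pow, Ideal.mem_span_singleton] at h3
  · intro h
    rw [Polynomial.X_pow_dvd_iff] at h
    rw [← eval_one_contraction P f, Polynomial.eval_eq_sum, Polynomial.sum]
    refine Ideal.sum_mem _ fun k _ => ?_
    rw [one_pow, mul_one]
    by_cases hk : k < m
    · rw [h k hk]; exact zero_mem _
    · exact Ideal.pow_le_pow_right (not_lt.mp hk) (contraction_coeff_mem P f k)

theorem eval_eq_zero_of_mem_pointIdeal {P : Plane K} {f : MvPolynomial (Fin 3) K}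
    (hf : f ∈ pointIdeal P) : eval P.rep f = 0 := by
  have : pointIdeal P ≤ RingHom.ker (eval P.rep) := by
    rw [pointIdeal, Ideal.span_le]
    rintro g ⟨-, hg⟩
    exact hg
  exact this hf

theorem X_not_dvd_contraction {P : Plane K} {f : MvPolynomial (Fin 3) K}
    (hf : eval P.rep f ≠ 0) : ¬ Polynomial.X ∣ contraction P f := by
  intro h
  rw [← pow_one Polynomial.X, ← mem_pointIdeal_pow_iff, pow_one] at h
  exact hf (eval_eq_zero_of_mem_pointIdeal h)

theorem mem_pow_of_mul_mem_of_eval_ne_zero {P : Plane K} {l g : MvPolynomial (Fin 3) K} {m : ℕ}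
    (hl : eval P.rep l ≠ 0) (h : l * g ∈ pointIdeal P ^ m) : g ∈ pointIdeal P ^ m := by
  rw [mem_pointIdeal_pow_iff] at h ⊢
  rw [map_mul] at h
  exact Polynomial.prime_X.pow_dvd_of_dvd_mul_left _ (X_not_dvd_contraction hl) h

theorem contraction_linForm (P : Plane K) (c : Fin 3 → K) :
    ∃ a b, contraction P (linForm c) = Polynomial.C a + Polynomial.X * Polynomial.C b := by
  refine ⟨∑ i, C (c i) * (C (P.rep i) * unitForm P), ∑ i, C (c i) * normalForm P i, ?_⟩
  simp only [linForm, contraction, map_sum, map_mul, aeval_X, Finset.mul_sum,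
    ← Finset.sum_add_distrib]
  refine Finset.sum_congr rfl fun i _ => ?_
  rw [show (aeval _) (C (c i) : MvPolynomial (Fin 3) K) = Polynomial.C (C (c i)) from aeval_C _ _]
  ring

/-- A linear form through `P` contracts to the parameter times a nonzero constant polynomial, so
cancelling it costs exactly one power. -/
theorem mem_pow_of_linForm_mul_mem {P : Plane K} {c : Fin 3 → K} (hc : c ≠ 0)
    {g : MvPolynomial (Fin 3) K} {m : ℕ}
    (hl : ∑ i, c i * P.rep i = 0) (h : linForm c * g ∈ pointIdeal P ^ m) :
    g ∈ pointIdeal P ^ (m - 1) := by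
  rcases m with _ | m
  · simp
  have hl' : linForm c ∈ pointIdeal P :=
    mem_pointIdeal_of_eval_eq_zero (linForm_isHomogeneous c) (by simpa using hl)
  rw [← pow_one (pointIdeal P), mem_pointIdeal_pow_iff, pow_one] at hl'
  rw [mem_pointIdeal_pow_iff] at h ⊢
  rw [map_mul] at h
  obtain ⟨a, b, hab⟩ := contraction_linForm P c
  have ha : a = 0 := by
    rw [hab, Polynomial.X_dvd_iff] at hl'
    simpa using hl'
  subst ha
  have hb : b ≠ 0 := by
    rintro rfl
    have h1 := eval_one_contraction P (linForm c)
    rw [hab] at h1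
    exact linForm_ne_zero hc (by rw [← h1]; simp)
  rw [hab, Polynomial.C_0, zero_add, mul_assoc, pow_succ', ] at h
  have h2 := (mul_dvd_mul_iff_left Polynomial.X_ne_zero).mp h
  refine Polynomial.prime_X.pow_dvd_of_dvd_mul_left _ ?_ h2
  rw [Polynomial.X_dvd_iff]
  simpa using hb

/-! ### Graded pieces and the number of conditions imposed by fat points -/

instance finite_homogeneousSubmodule (t : ℕ) :
    Module.Finite K (homogeneousSubmodule (Fin 3) K t) :=
  Module.Finite.iff_fg.mpr (homogeneousSubmodule_fg _ _ t)

theorem gradedPart_le (I : Ideal (MvPolynomial (Fin 3) K)) (t : ℕ) :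
    gradedPart I t ≤ homogeneousSubmodule (Fin 3) K t := inf_le_left

theorem mem_gradedPart {I : Ideal (MvPolynomial (Fin 3) K)} {t : ℕ}
    {f : MvPolynomial (Fin 3) K} : f ∈ gradedPart I t ↔ f.IsHomogeneous t ∧ f ∈ I := by
  rw [gradedPart, Submodule.mem_inf, mem_homogeneousSubmodule, Submodule.restrictScalars_mem]

instance finite_gradedPart (I : Ideal (MvPolynomial (Fin 3) K)) (t : ℕ) :
    Module.Finite K (gradedPart I t) :=
  Submodule.finiteDimensional_of_le (gradedPart_le I t)

theorem finrank_homogeneousSubmodule (t : ℕ) :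
    Module.finrank K (homogeneousSubmodule (Fin 3) K t) = (t + 2).choose 2 := by
  have hS : ∀ d : Fin 3 →₀ ℕ, d ∈ Finset.univ.finsuppAntidiag t ↔ d ∈ {d | d.degree = t} := by
    intro d
    simp [Finset.mem_finsuppAntidiag, Finsupp.degree_eq_sum]
  let _ : Fintype {d : Fin 3 →₀ ℕ | d.degree = t} := Fintype.ofFinset _ hS
  rw [homogeneousSubmodule_eq_finsupp_supported,
    (AddMonoidAlgebra.supportedEquivFinsupp (R := K) (S := K)
      {d : Fin 3 →₀ ℕ | d.degree = t}).finrank_eq, Module.finrank_finsupp_self,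
    Fintype.card_ofFinset, Finset.card_finsuppAntidiag_nat_eq_choose]
  rw [Finset.card_univ, Fintype.card_fin, show 3 + t - 1 = t + 2 by omega,
    Nat.choose_symm_add]

theorem mem_pow_triple {A : Type*} [CommSemiring A] (x y z : A) (t : ℕ) {a : A}
    (ha : a ∈ ({x, y, z} : Set A) ^ t) :
    ∃ i j k, i + (j + k) = t ∧ a = x ^ i * (y ^ j * z ^ k) := by
  induction t generalizing a with
  | zero => exact ⟨0, 0, 0, rfl, by simpa using ha⟩
  | succ t ih =>
    rw [pow_succ, Set.mem_mul] at ha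
    obtain ⟨b, hb, c, hc, rfl⟩ := ha
    obtain ⟨i, j, k, h, rfl⟩ := ih hb
    rcases hc with rfl | rfl | rfl
    · exact ⟨i + 1, j, k, by omega, by ring⟩
    · exact ⟨i, j + 1, k, by omega, by ring⟩
    · exact ⟨i, j, k + 1, by omega, by ring⟩

/-- The normal form at the pivot is zero, so three linear forms adapted to `P` suffice. -/
theorem homogeneousSubmodule_one_le_span (P : Plane K) :
    homogeneousSubmodule (Fin 3) K 1 ≤ Submodule.span K
      {unitForm P, normalForm P (pivot P + 1), normalForm P (pivot P + 2)} := by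
  rw [homogeneousSubmodule_one_eq_span_X, Submodule.span_le]
  rintro _ ⟨i, rfl⟩
  have hX : (X i : MvPolynomial (Fin 3) K) = normalForm P i + P.rep i • unitForm P := by
    rw [normalForm, smul_eq_C_mul]; ring
  rw [SetLike.mem_coe, hX]
  refine add_mem ?_ (Submodule.smul_mem _ _ (Submodule.subset_span (by simp)))
  have hi : ∀ i j : Fin 3, i = j ∨ i = j + 1 ∨ i = j + 2 := by decide
  rcases hi i (pivot P) with h | h | h
  · rw [h, normalForm_pivot]; exact zero_mem _
  · rw [h]; exact Submodule.subset_span (by simp)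
  · rw [h]; exact Submodule.subset_span (by simp)

theorem sum_range_succ_eq_choose (m : ℕ) : ∑ k ∈ Finset.range m, (k + 1) = (m + 1).choose 2 := by
  induction m with
  | zero => rfl
  | succ m ih => rw [Finset.sum_range_succ, ih, Nat.choose_succ_succ' (m + 1) 1]; simp; ring

/-- A point of multiplicity `m` imposes at most `m (m + 1) / 2` conditions. -/
theorem finrank_le_gradedPart_pow (P : Plane K) (m t : ℕ) :
    Module.finrank K (homogeneousSubmodule (Fin 3) K t) ≤
      Module.finrank K (gradedPart (pointIdeal P ^ m) t) + (m + 1).choose 2 := by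
  classical
  set x := unitForm P
  set y := normalForm P (pivot P + 1)
  set z := normalForm P (pivot P + 2)
  -- Exponents of the two normal forms of total degree below `m`: the monomials not already in the
  -- `m`-th power of the point ideal.
  set S := (Finset.range m).biUnion fun k => Finset.HasAntidiagonal.antidiagonal k
  set T := S.image fun q => x ^ (t - (q.1 + q.2)) * (y ^ q.1 * z ^ q.2)
  have hT : T.card ≤ (m + 1).choose 2 := by
    refine Finset.card_image_le.trans (Finset.card_biUnion_le.trans ?_)
    simp [sum_range_succ_eq_choose]
  have hle : homogeneousSubmodule (Fin 3) K t ≤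
      gradedPart (pointIdeal P ^ m) t ⊔ Submodule.span K (T : Set (MvPolynomial (Fin 3) K)) := by
    rw [← homogeneousSubmodule_one_pow]
    refine (pow_le_pow_left' (homogeneousSubmodule_one_le_span P) t).trans ?_
    rw [Submodule.span_pow, Submodule.span_le]
    intro a ha
    obtain ⟨i, j, k, h, rfl⟩ := mem_pow_triple _ _ _ _ ha
    by_cases hm : j + k < m
    · refine Submodule.mem_sup_right (Submodule.subset_span ?_)
      rw [Finset.mem_coe, Finset.mem_image]
      refine ⟨(j, k), ?_, ?_⟩
      · simpa [S] using hm
      · simp only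
        rw [show t - (j + k) = i by omega]
    · refine Submodule.mem_sup_left (mem_gradedPart.mpr ⟨?_, ?_⟩)
      · have := ((unitForm_isHomogeneous P).pow i).mul
          (((normalForm_isHomogeneous P (pivot P + 1)).pow j).mul
            ((normalForm_isHomogeneous P (pivot P + 2)).pow k))
        simpa only [one_mul, h] using this
      · refine Ideal.mul_mem_left _ _ (Ideal.pow_le_pow_right (not_lt.mp hm) ?_)
        rw [pow_add]
        exact Ideal.mul_mem_mul (Ideal.pow_mem_pow (normalForm_mem _ _) _)
          (Ideal.pow_mem_pow (normalForm_mem _ _) _)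
  calc _ ≤ _ := Submodule.finrank_mono hle
    _ ≤ _ := Submodule.finrank_add_le_finrank_add_finrank _ _
    _ ≤ _ := by
      gcongr
      exact (finrank_span_finset_le_card T).trans hT

/-- The ideal of the fat point scheme with multiplicity `μ P` at each `P ∈ X`. -/
noncomputable def multIdeal (X : Finset (Plane K)) (μ : Plane K → ℕ) :
    Ideal (MvPolynomial (Fin 3) K) :=
  ⨅ P ∈ X, pointIdeal P ^ μ P

theorem mem_multIdeal {X : Finset (Plane K)} {μ : Plane K → ℕ} {f : MvPolynomial (Fin 3) K} :
    f ∈ multIdeal X μ ↔ ∀ P ∈ X, f ∈ pointIdeal P ^ μ P := by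
  simp [multIdeal, Submodule.mem_iInf]

/-- Codimensions are subadditive under intersection inside the space of forms of degree `t`. -/
theorem finrank_le_gradedPart_multIdeal (X : Finset (Plane K)) (μ : Plane K → ℕ) (t : ℕ) :
    Module.finrank K (homogeneousSubmodule (Fin 3) K t) ≤
      Module.finrank K (gradedPart (multIdeal X μ) t) + ∑ P ∈ X, (μ P + 1).choose 2 := by
  classical
  induction X using Finset.induction_on with
  | empty =>
    have : gradedPart (multIdeal (∅ : Finset (Plane K)) μ) t =
        homogeneousSubmodule (Fin 3) K t := by
      ext f
      simp [mem_gradedPart, mem_multIdeal]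
    rw [this]
    simp
  | insert P X hP ih =>
    have h : gradedPart (multIdeal (insert P X) μ) t =
        gradedPart (pointIdeal P ^ μ P) t ⊓ gradedPart (multIdeal X μ) t := by
      ext f
      simp only [mem_gradedPart, mem_multIdeal, Submodule.mem_inf, Finset.forall_mem_insert]
      tauto
    have h1 := finrank_le_gradedPart_pow P (μ P) t
    have h2 := Submodule.finrank_sup_add_finrank_inf_eq
      (gradedPart (pointIdeal P ^ μ P) t) (gradedPart (multIdeal X μ) t)
    have h3 := Submodule.finrank_mono
      (sup_le (gradedPart_le (pointIdeal P ^ μ P) t) (gradedPart_le (multIdeal X μ) t))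
    rw [Finset.sum_insert hP, h]
    omega

/-! ### Lines: equations, parametrizations and restriction of forms -/

theorem mem_points_iff {L : Line K} {P : Plane K} : P ∈ L.points ↔ P.rep ∈ L.1 := by
  rw [Line.points, Set.mem_ofPred_eq, Projectivization.submodule_eq,
    Submodule.span_singleton_le_iff_mem]

/-- A line is the zero set of a nonzero linear form. -/
theorem exists_covector (L : Line K) :
    ∃ c : Fin 3 → K, c ≠ 0 ∧ ∀ x, x ∈ L.1 ↔ ∑ i, c i * x i = 0 := by
  have hlt : L.1 < ⊤ := by
    rw [lt_top_iff_ne_top]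
    intro h
    have := L.2
    rw [h] at this
    simp at this
  obtain ⟨f, hf, hle⟩ := Submodule.exists_le_ker_of_lt_top _ hlt
  have hker : L.1 = LinearMap.ker f := by
    refine Submodule.eq_of_le_of_finrank_eq hle ?_
    have h1 := LinearMap.finrank_range_add_finrank_ker f
    rw [LinearMap.range_eq_top.mpr (LinearMap.surjective hf), L.2] at *
    simp at h1
    omega
  have hsum : ∀ x : Fin 3 → K, f x = ∑ i, f (Pi.single i 1) * x i := by
    intro x
    conv_lhs => rw [← LinearMap.sum_single_apply (φ := fun _ : Fin 3 => K) x]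
    rw [map_sum]
    refine Finset.sum_congr rfl fun i _ => ?_
    rw [mul_comm, ← smul_eq_mul, ← map_smul]
    congr 1
    ext j
    simp [Pi.single_apply]
  refine ⟨fun i => f (Pi.single i 1), ?_, fun x => ?_⟩
  · intro h
    apply hf
    ext1 x
    ext
    simpa using congrFun h x
  · rw [hker, LinearMap.mem_ker, hsum]

/-- Restriction of a polynomial to the affine line `z ↦ u + z v`. -/
noncomputable def restrict (u v : Fin 3 → K) : MvPolynomial (Fin 3) K →ₐ[K] Polynomial K :=
  aeval fun i => Polynomial.C (u i) + Polynomial.X * Polynomial.C (v i)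

theorem eval_restrict (u v : Fin 3 → K) (f : MvPolynomial (Fin 3) K) (z : K) :
    (restrict u v f).eval z = eval (u + z • v) f := by
  have : (Polynomial.aeval z).comp (restrict u v) = aeval (u + z • v) := by
    ext i
    simp [restrict, mul_comm z]
  simpa [aeval_eq_eval, Polynomial.aeval_def] using congrArg (fun φ => φ f) this

theorem natDegree_restrict_le {f : MvPolynomial (Fin 3) K} {t : ℕ} (hf : f.IsHomogeneous t)
    (u v : Fin 3 → K) : (restrict u v f).natDegree ≤ t := by
  rw [restrict, aeval_def, eval₂_eq']
  refine Polynomial.natDegree_sum_le_of_forall_le _ _ fun d hd => ?_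
  have hdeg : ∑ i, d i = t := by
    rw [← Finsupp.degree_eq_sum]
    exact (hf.degree_eq_sum_deg_support hd).symm
  refine Polynomial.natDegree_mul_le.trans ?_
  rw [show algebraMap K (Polynomial K) = Polynomial.C from rfl, Polynomial.natDegree_C, zero_add]
  refine (Polynomial.natDegree_prod_le _ _).trans ?_
  rw [← hdeg]
  refine Finset.sum_le_sum fun i _ => ?_
  refine Polynomial.natDegree_pow_le.trans ?_
  refine (Nat.mul_le_mul_left _ (m := 1) ?_).trans (by simp)
  refine Polynomial.natDegree_add_le_of_degree_le (by simp) ?_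
  exact Polynomial.natDegree_mul_le.trans (by simp)

theorem dvd_restrict_of_mem_pow {P : Plane K} {u v : Fin 3 → K} {a z : K} (ha : a ≠ 0)
    (hP : P.rep = a • (u + z • v)) {f : MvPolynomial (Fin 3) K} {m : ℕ}
    (hf : f ∈ pointIdeal P ^ m) : (Polynomial.X - Polynomial.C z) ^ m ∣ restrict u v f := by
  have h1 : (pointIdeal P).map (restrict u v) ≤ Ideal.span {Polynomial.X - Polynomial.C z} := by
    rw [pointIdeal, Ideal.map_span, Ideal.span_le]
    rintro _ ⟨g, ⟨⟨n, hg⟩, h0⟩, rfl⟩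
    rw [SetLike.mem_coe, Ideal.mem_span_singleton, Polynomial.dvd_iff_isRoot,
      Polynomial.IsRoot.def, eval_restrict]
    rw [hP, eval_smul_of_isHomogeneous hg] at h0
    exact (mul_eq_zero.mp h0).resolve_left (pow_ne_zero _ ha)
  have h2 : restrict u v f ∈ ((pointIdeal P) ^ m).map (restrict u v) := Ideal.mem_map_of_mem _ hf
  rw [Ideal.map_pow] at h2
  have h3 := Ideal.pow_right_mono h1 m h2
  rwa [Ideal.span_singleton_pow, Ideal.mem_span_singleton] at h3

/-- Project onto the plane `linForm c = 0` along a coordinate with nonzero coefficient. This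
substitution changes `f` only modulo `linForm c`, and its result vanishes everywhere, hence is zero
over an infinite field. -/
theorem linForm_dvd_of_eval_eq_zero [Infinite K] {c : Fin 3 → K} (hc : c ≠ 0)
    {f : MvPolynomial (Fin 3) K} (hf : ∀ x, ∑ i, c i * x i = 0 → eval x f = 0) :
    linForm c ∣ f := by
  obtain ⟨j, hj⟩ : ∃ j, c j ≠ 0 := by
    by_contra! h
    exact hc (funext h)
  let φ : MvPolynomial (Fin 3) K →ₐ[K] MvPolynomial (Fin 3) K :=
    aeval fun i => X i - C ((Pi.single j (c j)⁻¹ : Fin 3 → K) i) * linForm c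
  have h0 : φ f = 0 := by
    refine MvPolynomial.funext fun x => ?_
    have h : eval x (φ f) =
        eval (fun i => x i - (Pi.single j (c j)⁻¹ : Fin 3 → K) i * ∑ k, c k * x k) f := by
      have : (aeval x).comp φ =
          aeval (fun i => x i - (Pi.single j (c j)⁻¹ : Fin 3 → K) i * ∑ k, c k * x k) := by
        ext i
        simp [φ, aeval_eq_eval]
      simpa [aeval_eq_eval] using congrArg (fun ψ => ψ f) this
    rw [h, map_zero]
    refine hf _ ?_
    simp only [mul_sub, Finset.sum_sub_distrib, ← mul_assoc, ← Finset.sum_mul]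
    simp [Pi.single_apply, hj]
  have h1 : (Ideal.Quotient.mkₐ K (Ideal.span {linForm c})).comp φ =
      Ideal.Quotient.mkₐ K (Ideal.span {linForm c}) := by
    ext i
    simp only [AlgHom.comp_apply, φ, aeval_X, Ideal.Quotient.mkₐ_eq_mk]
    rw [Ideal.Quotient.mk_eq_mk_iff_sub_mem, sub_sub_cancel_left, neg_mem_iff]
    exact Ideal.mul_mem_left _ _ (Ideal.mem_span_singleton_self _)
  have h2 := congrArg (fun ψ => ψ f) h1
  simp only [AlgHom.comp_apply, h0, map_zero, Ideal.Quotient.mkₐ_eq_mk] at h2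
  rw [← Ideal.mem_span_singleton]
  exact Ideal.Quotient.eq_zero_iff_mem.mp h2.symm

theorem exists_isHomogeneous_of_linForm_dvd {c : Fin 3 → K} {f : MvPolynomial (Fin 3) K} {t : ℕ}
    (hf : f.IsHomogeneous (t + 1)) (h : linForm c ∣ f) :
    ∃ g : MvPolynomial (Fin 3) K, g.IsHomogeneous t ∧ f = linForm c * g := by
  obtain ⟨g, rfl⟩ := h
  refine ⟨homogeneousComponent t g, homogeneousComponent_isHomogeneous t g, ?_⟩
  have h1 : homogeneousComponent (t + 1) (linForm c * g) =
      linForm c * homogeneousComponent t g := by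
    conv_lhs => rw [← sum_homogeneousComponent g, Finset.mul_sum, map_sum]
    have h2 : ∀ i, homogeneousComponent (t + 1) (linForm c * homogeneousComponent i g) =
        if i = t then linForm c * homogeneousComponent i g else 0 := by
      intro i
      rw [homogeneousComponent_of_mem (n := 1 + i)
        ((linForm_isHomogeneous c).mul (homogeneousComponent_isHomogeneous i g))]
      by_cases h : i = t
      · rw [if_pos h, if_pos (by omega)]
      · rw [if_neg h, if_neg (by omega)]
    simp only [h2, Finset.sum_ite_eq', Finset.mem_range]
    split_ifs with h3
    · rfl
    · rw [homogeneousComponent_eq_zero _ _ (by omega), mul_zero]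
  rw [← h1, homogeneousComponent_eq_self hf]

theorem eq_of_rep_eq_smul {P Q : Plane K} {w : Fin 3 → K} {a b : K}
    (hP : P.rep = a • w) (hQ : Q.rep = b • w) : P = Q := by
  have ha : a ≠ 0 := by rintro rfl; exact P.rep_nonzero (by simpa using hP)
  have hb : b ≠ 0 := by rintro rfl; exact Q.rep_nonzero (by simpa using hQ)
  apply Projectivization.submodule_injective
  rw [Projectivization.submodule_eq, Projectivization.submodule_eq, hP, hQ,
    Submodule.span_singleton_smul_eq ha.isUnit, Submodule.span_singleton_smul_eq hb.isUnit]

/-- A line has an affine parametrization whose point at infinity avoids a finite set. -/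
theorem exists_parametrization [Infinite K] (X : Finset (Plane K)) (L : Line K) :
    ∃ u v : Fin 3 → K, u ∈ L.1 ∧ v ∈ L.1 ∧ (∀ x ∈ L.1, ∃ a b : K, x = a • u + b • v) ∧
      ∀ P ∈ X, P ∈ L.points → ∃ a z : K, a ≠ 0 ∧ P.rep = a • (u + z • v) := by
  classical
  let B := Module.finBasisOfFinrankEq K L.1 L.2
  have hB : ∀ x ∈ L.1, ∃ a b : K, x = a • (B 0 : Fin 3 → K) + b • (B 1 : Fin 3 → K) := by
    intro x hx
    have h := congrArg Subtype.val (B.sum_repr ⟨x, hx⟩)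
    simp only [Fin.sum_univ_two] at h
    exact ⟨_, _, by simpa using h.symm⟩
  have hch : ∀ P : Plane K, ∃ q : K × K, P ∈ L.points →
      P.rep = q.1 • (B 0 : Fin 3 → K) + q.2 • (B 1 : Fin 3 → K) := by
    intro P
    by_cases hP : P ∈ L.points
    · obtain ⟨a, b, h⟩ := hB _ (mem_points_iff.mp hP)
      exact ⟨(a, b), fun _ => h⟩
    · exact ⟨0, fun h => absurd h hP⟩
  choose q hq using hch
  -- Avoiding these ratios keeps the point at infinity `B 0 + z • B 1` off `X`. A vanishing first
  -- coordinate gives a meaningless ratio and is treated separately.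
  obtain ⟨z, hz⟩ := Infinite.exists_notMem_finset (X.image fun P => (q P).2 / (q P).1)
  refine ⟨B 1, B 0 + z • B 1, (B 1).2, add_mem (B 0).2 (L.1.smul_mem _ (B 1).2), ?_, ?_⟩
  · intro x hx
    obtain ⟨a, b, rfl⟩ := hB x hx
    refine ⟨b - a * z, a, ?_⟩
    module
  · intro P hP hPL
    have h := hq P hPL
    have hne : (q P).2 - (q P).1 * z ≠ 0 := by
      intro h0
      by_cases h1 : (q P).1 = 0
      · have h2 : (q P).2 = 0 := by simpa [h1] using h0
        exact P.rep_nonzero (by rw [h, h1, h2]; simp)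
      · refine hz (Finset.mem_image.mpr ⟨P, hP, ?_⟩)
        rw [sub_eq_zero.mp h0, mul_div_cancel_left₀ _ h1]
    refine ⟨_, (q P).1 / ((q P).2 - (q P).1 * z), hne, ?_⟩
    rw [h, smul_add, smul_smul, mul_div_cancel₀ _ hne]
    module

/-- Homogeneity handles every point except the one at infinity; there, a one-variable polynomial
vanishing away from `0` is zero. -/
theorem eval_eq_zero_of_restrict_eq_zero [Infinite K] {f : MvPolynomial (Fin 3) K} {t : ℕ}
    (hf : f.IsHomogeneous t) {u v : Fin 3 → K} (h : restrict u v f = 0) (a b : K) :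
    eval (a • u + b • v) f = 0 := by
  have hne : ∀ a : K, a ≠ 0 → eval (a • u + b • v) f = 0 := by
    intro a ha
    have h1 : a • u + b • v = a • (u + (b / a) • v) := by
      rw [smul_add, smul_smul, mul_div_cancel₀ _ ha]
    rw [h1, eval_smul_of_isHomogeneous hf, ← eval_restrict, h]
    simp
  have h0 : restrict (b • v) u f = 0 := by
    refine Polynomial.eq_zero_of_infinite_isRoot _ (Set.Infinite.mono ?_
      (Set.finite_singleton (0 : K)).infinite_compl)
    intro y hy
    have := hne y (by simpa using hy)
    rw [add_comm, ← eval_restrict] at this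
    exact this
  rw [add_comm, ← eval_restrict, h0]
  simp

/-! ### Residuation along a line and the defect -/

/-- Lower the multiplicities by one along a line. -/
noncomputable def reduce (μ : Plane K → ℕ) (L : Line K) (P : Plane K) : ℕ :=
  open scoped Classical in if P ∈ L.points then μ P - 1 else μ P

/-- The points of `X` on the line `L`. -/
noncomputable def onLine (X : Finset (Plane K)) (L : Line K) : Finset (Plane K) :=
  open scoped Classical in X.filter (· ∈ L.points)

theorem mem_onLine {X : Finset (Plane K)} {L : Line K} {P : Plane K} :
    P ∈ onLine X L ↔ P ∈ X ∧ P ∈ L.points := by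
  simp [onLine]

theorem finrank_degreeLT (n : ℕ) : Module.finrank K (Polynomial.degreeLT K n) = n := by
  rw [(Polynomial.degreeLTEquiv K n).finrank_eq, Module.finrank_fin_fun]

/-- Forms in the ideal of a fat point scheme, restricted to a line. -/
theorem finrank_gradedPart_le_add [Infinite K] (X : Finset (Plane K)) (μ : Plane K → ℕ)
    (L : Line K) (t : ℕ) (W : Submodule K (MvPolynomial (Fin 3) K)) [Module.Finite K W]
    (hW : ∀ f ∈ gradedPart (multIdeal X μ) t, (∀ x ∈ L.1, eval x f = 0) → f ∈ W) :
    Module.finrank K (gradedPart (multIdeal X μ) t) ≤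
      Module.finrank K W + (t + 1 - ∑ P ∈ onLine X L, μ P) := by
  obtain ⟨u, v, -, -, huv, hpar⟩ := exists_parametrization X L
  have hch : ∀ P : Plane K, ∃ q : K × K, P ∈ onLine X L →
      q.1 ≠ 0 ∧ P.rep = q.1 • (u + q.2 • v) := by
    intro P
    by_cases hP : P ∈ onLine X L
    · obtain ⟨hX, hL⟩ := mem_onLine.mp hP
      obtain ⟨a, z, h⟩ := hpar P hX hL
      exact ⟨(a, z), fun _ => h⟩
    · exact ⟨0, fun h => absurd h hP⟩
  choose q hq using hch
  set e := ∑ P ∈ onLine X L, μ P with he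
  set Q : Polynomial K := ∏ P ∈ onLine X L, (Polynomial.X - Polynomial.C (q P).2) ^ μ P with hQ
  have hQm : Q.Monic := Polynomial.monic_prod_of_monic _ _
    fun P _ => (Polynomial.monic_X_sub_C _).pow _
  have hQd : Q.natDegree = e := by
    rw [hQ, Polynomial.natDegree_prod_of_monic _ _ fun P _ => (Polynomial.monic_X_sub_C _).pow _]
    simp [he]
  set V := gradedPart (multIdeal X μ) t
  let ρ := (restrict u v).toLinearMap.domRestrict V
  have hrange : Module.finrank K (LinearMap.range ρ) ≤ t + 1 - e := by
    -- A restriction has degree at most `t` and is divisible by `Q`, of degree `e`. For `e > t` the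
    -- truncated bound is `0`, and the restriction vanishes.
    have hle : LinearMap.range ρ ≤
        (Polynomial.degreeLT K (t + 1 - e)).map (LinearMap.mulLeft K Q) := by
      rintro _ ⟨⟨f, hf⟩, rfl⟩
      obtain ⟨hhom, hmem⟩ := mem_gradedPart.mp hf
      have hdvd : Q ∣ restrict u v f := by
        refine Finset.prod_dvd_of_coprime ?_ fun P hP => ?_
        · intro P hP R hR hne
          refine IsCoprime.pow (Polynomial.isCoprime_X_sub_C_of_isUnit_sub ?_)
          rw [isUnit_iff_ne_zero, sub_ne_zero]
          intro hz
          refine hne (eq_of_rep_eq_smul (b := (q R).1) (hq P hP).2 ?_)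
          rw [hz]
          exact (hq R hR).2
        · exact dvd_restrict_of_mem_pow (hq P hP).1 (hq P hP).2
            (mem_multIdeal.mp hmem P (mem_onLine.mp hP).1)
      obtain ⟨g, hg⟩ := hdvd
      refine ⟨g, ?_, hg.symm⟩
      rw [SetLike.mem_coe, Polynomial.mem_degreeLT]
      by_cases hg0 : g = 0
      · rw [hg0, Polynomial.degree_zero]; exact WithBot.bot_lt_coe _
      have h1 := natDegree_restrict_le hhom u v
      rw [hg, hQm.natDegree_mul' hg0, hQd] at h1
      rw [Polynomial.degree_eq_natDegree hg0]
      exact_mod_cast (by omega : g.natDegree < t + 1 - e)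
    refine (Submodule.finrank_mono hle).trans ?_
    refine (Submodule.finrank_map_le _ _).trans ?_
    rw [finrank_degreeLT]
  have hker : Module.finrank K (LinearMap.ker ρ) ≤ Module.finrank K W := by
    rw [← Submodule.finrank_map_subtype_eq]
    refine Submodule.finrank_mono ?_
    rintro _ ⟨⟨f, hf⟩, h0, rfl⟩
    refine hW f hf fun x hx => ?_
    obtain ⟨a, b, rfl⟩ := huv x hx
    exact eval_eq_zero_of_restrict_eq_zero (mem_gradedPart.mp hf).1 h0 a b
  have := LinearMap.finrank_range_add_finrank_ker ρ
  omega

theorem mul_mem_multIdeal {X : Finset (Plane K)} {μ : Plane K → ℕ} {L : Line K} {c : Fin 3 → K}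
    (hL : ∀ x, x ∈ L.1 ↔ ∑ i, c i * x i = 0)
    {g : MvPolynomial (Fin 3) K} (hg : g ∈ multIdeal X (reduce μ L)) :
    linForm c * g ∈ multIdeal X μ := by
  rw [mem_multIdeal] at hg ⊢
  intro P hP
  have h := hg P hP
  by_cases hPL : P ∈ L.points
  · rw [reduce, if_pos hPL] at h
    have hl : linForm c ∈ pointIdeal P := mem_pointIdeal_of_eval_eq_zero (linForm_isHomogeneous c)
      (by rw [eval_linForm]; exact (hL _).mp (mem_points_iff.mp hPL))
    have h2 := Ideal.mul_mem_mul hl h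
    rw [← pow_succ'] at h2
    exact Ideal.pow_le_pow_right (by omega) h2
  · rw [reduce, if_neg hPL] at h
    exact Ideal.mul_mem_left _ _ h

theorem mem_multIdeal_of_mul_mem {X : Finset (Plane K)} {μ : Plane K → ℕ} {L : Line K}
    {c : Fin 3 → K} (hc : c ≠ 0) (hL : ∀ x, x ∈ L.1 ↔ ∑ i, c i * x i = 0)
    {g : MvPolynomial (Fin 3) K} (hg : linForm c * g ∈ multIdeal X μ) :
    g ∈ multIdeal X (reduce μ L) := by
  rw [mem_multIdeal] at hg ⊢
  intro P hP
  have h := hg P hP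
  by_cases hPL : P ∈ L.points
  · rw [reduce, if_pos hPL]
    exact mem_pow_of_linForm_mul_mem hc ((hL _).mp (mem_points_iff.mp hPL)) h
  · rw [reduce, if_neg hPL]
    refine mem_pow_of_mul_mem_of_eval_ne_zero ?_ h
    rw [eval_linForm]
    exact fun h0 => hPL (mem_points_iff.mpr ((hL _).mpr h0))

/-- This is the residual exact sequence: the forms vanishing on `L` are the multiples of its
equation by forms in the residual ideal. -/
theorem finrank_gradedPart_succ_le [Infinite K] (X : Finset (Plane K)) (μ : Plane K → ℕ)
    (L : Line K) (t : ℕ) :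
    Module.finrank K (gradedPart (multIdeal X μ) (t + 1)) ≤
      Module.finrank K (gradedPart (multIdeal X (reduce μ L)) t) +
        (t + 2 - ∑ P ∈ onLine X L, μ P) := by
  obtain ⟨c, hc, hL⟩ := exists_covector L
  refine (finrank_gradedPart_le_add X μ L (t + 1) ((gradedPart (multIdeal X (reduce μ L)) t).map
    (LinearMap.mulLeft K (linForm c))) ?_).trans ?_
  · intro f hf hvan
    obtain ⟨hhom, hmem⟩ := mem_gradedPart.mp hf
    obtain ⟨g, hg, rfl⟩ := exists_isHomogeneous_of_linForm_dvd hhom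
      (linForm_dvd_of_eval_eq_zero hc fun x hx => hvan x ((hL x).mpr hx))
    exact ⟨g, mem_gradedPart.mpr ⟨hg, mem_multIdeal_of_mul_mem hc hL hmem⟩, rfl⟩
  · have := Submodule.finrank_map_le (LinearMap.mulLeft K (linForm c))
      (gradedPart (multIdeal X (reduce μ L)) t)
    omega

theorem finrank_gradedPart_zero_le [Infinite K] (X : Finset (Plane K)) (μ : Plane K → ℕ)
    (L : Line K) :
    Module.finrank K (gradedPart (multIdeal X μ) 0) ≤ 1 - ∑ P ∈ onLine X L, μ P := by
  have h := finrank_gradedPart_le_add X μ L 0 ⊥ ?_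
  · simpa using h
  · intro f hf hvan
    have h1 := (mem_gradedPart.mp hf).1
    rw [← mem_homogeneousSubmodule, homogeneousSubmodule_zero, Submodule.mem_one] at h1
    obtain ⟨a, rfl⟩ := h1
    have := hvan 0 (zero_mem _)
    rw [Submodule.mem_bot]
    simpa [algebraMap_eq] using this

theorem finrank_gradedPart_reduce_le (X : Finset (Plane K)) (μ : Plane K → ℕ)
    (L : Line K) (t : ℕ) :
    Module.finrank K (gradedPart (multIdeal X (reduce μ L)) t) ≤
      Module.finrank K (gradedPart (multIdeal X μ) (t + 1)) := by
  obtain ⟨c, hc, hL⟩ := exists_covector L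
  have hinj : Function.Injective (LinearMap.mulLeft K (linForm c)) :=
    fun _ _ h => mul_left_cancel₀ (linForm_ne_zero hc) h
  rw [(Submodule.equivMapOfInjective _ hinj
    (gradedPart (multIdeal X (reduce μ L)) t)).finrank_eq]
  refine Submodule.finrank_mono ?_
  rintro _ ⟨g, hg, rfl⟩
  obtain ⟨hhom, hmem⟩ := mem_gradedPart.mp hg
  refine mem_gradedPart.mpr ⟨?_, mul_mem_multIdeal hL hmem⟩
  rw [add_comm]
  exact (linForm_isHomogeneous c).mul hhom

/-- The Hilbert function shifted by one, so that it is defined at `-1`. -/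
noncomputable def shiftedHilbert (I : Ideal (MvPolynomial (Fin 3) K)) : ℕ → ℤ
  | 0 => 0
  | n + 1 => hilbertFunction I n

/-- The degree of a fat point scheme. -/
def fatDegree (X : Finset (Plane K)) (μ : Plane K → ℕ) : ℕ := ∑ P ∈ X, (μ P + 1).choose 2

/-- The degree of a fat point scheme minus its Hilbert function in degree `n - 1`. -/
noncomputable def defect (X : Finset (Plane K)) (μ : Plane K → ℕ) (n : ℕ) : ℤ :=
  fatDegree X μ - shiftedHilbert (multIdeal X μ) n

theorem defect_nonneg (X : Finset (Plane K)) (μ : Plane K → ℕ) (n : ℕ) : 0 ≤ defect X μ n := by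
  rcases n with _ | n
  · simp [defect, shiftedHilbert]
  · have := finrank_le_gradedPart_multIdeal X μ n
    simp only [defect, shiftedHilbert, hilbertFunction, fatDegree]
    omega

/-- Lowering a multiplicity `k` by one lowers `(k + 1).choose 2` by `k`. -/
theorem fatDegree_reduce (X : Finset (Plane K)) (μ : Plane K → ℕ) (L : Line K) :
    fatDegree X μ = fatDegree X (reduce μ L) + ∑ P ∈ onLine X L, μ P := by
  rw [onLine, Finset.sum_filter, fatDegree, fatDegree, ← Finset.sum_add_distrib]
  refine Finset.sum_congr rfl fun P _ => ?_
  by_cases h : P ∈ L.points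
  · rw [reduce, if_pos h, if_pos h]
    rcases μ P with _ | k
    · rfl
    · rw [Nat.add_sub_cancel, Nat.choose_succ_succ' (k + 1) 1]
      simp [add_comm]
  · rw [reduce, if_neg h, if_neg h, add_zero]

theorem choose_succ_two (n : ℕ) : (n + 1 + 2).choose 2 = (n + 2).choose 2 + (n + 2) := by
  rw [show n + 1 + 2 = (n + 2) + 1 by omega, Nat.choose_succ_succ' (n + 2) 1]
  simp [add_comm]

/-- Index `n + 1` concerns forms of degree `n`, whose restrictions to `L` form an `(n +
1)`-dimensional space; the hypothesis says that the conditions on `L` can be independent there. -/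
theorem defect_succ_le [Infinite K] {X : Finset (Plane K)} {μ : Plane K → ℕ} {L : Line K} {n : ℕ}
    (h : ∑ P ∈ onLine X L, μ P ≤ n + 1) : defect X μ (n + 1) ≤ defect X (reduce μ L) n := by
  have hd := fatDegree_reduce X μ L
  rcases n with _ | n
  · have h1 := finrank_gradedPart_zero_le X μ L
    simp only [defect, shiftedHilbert, hilbertFunction, finrank_homogeneousSubmodule]
    simp only [Nat.zero_add, Nat.choose_self]
    omega
  · have h1 := finrank_gradedPart_succ_le X μ L n
    simp only [defect, shiftedHilbert, hilbertFunction, finrank_homogeneousSubmodule]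
    rw [choose_succ_two]
    omega

/-- With `n + 2` zeros on `L`, every form of degree `n` is divisible by its equation, so the two
ideals have equal dimensions; the line accounts for `n + 2` in the degree but only `n + 1` in the
Hilbert function. -/
theorem defect_succ_eq [Infinite K] {X : Finset (Plane K)} {μ : Plane K → ℕ} {L : Line K} {n : ℕ}
    (h : ∑ P ∈ onLine X L, μ P = n + 2) : defect X μ (n + 1) = defect X (reduce μ L) n + 1 := by
  have hd := fatDegree_reduce X μ L
  rcases n with _ | n
  · have h1 := finrank_gradedPart_zero_le X μ L
    simp only [defect, shiftedHilbert, hilbertFunction, finrank_homogeneousSubmodule]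
    simp only [Nat.zero_add, Nat.choose_self]
    omega
  · have h1 := finrank_gradedPart_succ_le X μ L n
    have h2 := finrank_gradedPart_reduce_le X μ L n
    simp only [defect, shiftedHilbert, hilbertFunction, finrank_homogeneousSubmodule]
    rw [choose_succ_two]
    omega

theorem defect_eq_zero_of_forall {X : Finset (Plane K)} {μ : Plane K → ℕ}
    (h : ∀ P ∈ X, μ P = 0) (n : ℕ) : defect X μ n = 0 := by
  have h0 : fatDegree X μ = 0 := Finset.sum_eq_zero fun P hP => by rw [h P hP]; rfl
  rcases n with _ | n
  · simp [defect, shiftedHilbert, h0]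
  · have : gradedPart (multIdeal X μ) n = homogeneousSubmodule (Fin 3) K n := by
      ext f
      rw [mem_gradedPart, mem_multIdeal, mem_homogeneousSubmodule, and_iff_left]
      intro P hP
      rw [h P hP, pow_zero, Ideal.one_eq_top]
      trivial
    simp only [defect, shiftedHilbert, hilbertFunction, h0]
    rw [this]
    simp

/-! ### Peeling off lists of lines -/

open scoped Classical in
/-- The number of lines of the list `l` through `P`. -/
noncomputable def through (l : List (Line K)) (P : Plane K) : ℕ :=
  l.countP fun L => decide (P ∈ L.points)

theorem through_append (l₁ l₂ : List (Line K)) (P : Plane K) :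
    through (l₁ ++ l₂) P = through l₁ P + through l₂ P := List.countP_append

theorem through_le_length (l : List (Line K)) (P : Plane K) : through l P ≤ l.length :=
  List.countP_le_length

theorem through_pos {l : List (Line K)} {L : Line K} {P : Plane K} (hL : L ∈ l)
    (hP : P ∈ L.points) : 1 ≤ through l P :=
  List.countP_pos_iff.mpr ⟨L, hL, by simpa using hP⟩

/-- The multiplicities remaining after peeling off the lines of `l`. -/
noncomputable def peel (μ : Plane K → ℕ) (l : List (Line K)) (P : Plane K) : ℕ :=
  μ P - through l P

@[simp]
theorem peel_nil (μ : Plane K → ℕ) : peel μ [] = μ := by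
  ext P; simp [peel, through]

theorem peel_append (μ : Plane K → ℕ) (l₁ l₂ : List (Line K)) :
    peel μ (l₁ ++ l₂) = peel (peel μ l₁) l₂ := by
  ext P; simp only [peel, through_append]; omega

theorem peel_cons (μ : Plane K → ℕ) (L : Line K) (l : List (Line K)) :
    peel μ (L :: l) = peel (reduce μ L) l := by
  ext P
  by_cases h : P ∈ L.points
  · simp only [peel, through, reduce, List.countP_cons, h, decide_true, if_true]; omega
  · simp [peel, through, reduce, h]

/-- Peeling off lines which impose independent conditions. -/
theorem defect_le_peel [Infinite K] {X : Finset (Plane K)} {μ : Plane K → ℕ} {n : ℕ}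
    (l : List (Line K))
    (h : ∀ l₁ L l₂, l = l₁ ++ L :: l₂ →
      (∑ P ∈ onLine X L, peel μ l₁ P) + l₁.length ≤ n + l.length) :
    defect X μ (n + l.length) ≤ defect X (peel μ l) n := by
  induction l generalizing μ with
  | nil => simp
  | cons L l ih =>
    rw [peel_cons, List.length_cons, ← add_assoc]
    refine (defect_succ_le (L := L) ?_).trans (ih ?_)
    · simpa [add_assoc] using h [] L l rfl
    · intro l₁ M l₂ hl
      have := h (L :: l₁) M l₂ (by rw [hl]; rfl)
      simp only [peel_cons, List.length_cons] at this
      omega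

/-- Peeling off lines on which the conditions fail to be independent by one. -/
theorem defect_eq_peel [Infinite K] {X : Finset (Plane K)} {μ : Plane K → ℕ} {n : ℕ}
    (l : List (Line K))
    (h : ∀ l₁ L l₂, l = l₁ ++ L :: l₂ →
      (∑ P ∈ onLine X L, peel μ l₁ P) + l₁.length = n + l.length + 1) :
    defect X μ (n + l.length) = defect X (peel μ l) n + l.length := by
  induction l generalizing μ with
  | nil => simp
  | cons L l ih =>
    rw [peel_cons, List.length_cons, ← add_assoc, defect_succ_eq (L := L), ih]
    · push_cast; ring
    · intro l₁ M l₂ hl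
      have := h (L :: l₁) M l₂ (by rw [hl]; rfl)
      simp only [peel_cons, List.length_cons] at this
      omega
    · simpa [add_assoc] using h [] L l rfl

theorem sum_through (X : Finset (Plane K)) (L : Line K) (l : List (Line K)) :
    ∑ P ∈ onLine X L, through l P = (l.map fun M => (onLine (onLine X L) M).card).sum := by
  induction l with
  | nil => simp [through]
  | cons M l ih =>
    have : ∀ P, through (M :: l) P = through l P +
        (open scoped Classical in if P ∈ M.points then 1 else 0) := by
      intro P
      by_cases h : P ∈ M.points <;> simp [through, h]
    simp only [this, Finset.sum_add_distrib, ih, List.map_cons, List.sum_cons]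
    rw [add_comm, Finset.sum_boole, Nat.cast_id]
    rfl

/-- The bound by `m` ensures that the subtraction in `peel` never truncates. -/
theorem sum_peel_const {X : Finset (Plane K)} {L : Line K} {l : List (Line K)} {m : ℕ}
    (h : ∀ P ∈ onLine X L, through l P ≤ m) :
    (∑ P ∈ onLine X L, peel (fun _ => m) l P) +
      (l.map fun M => (onLine (onLine X L) M).card).sum = m * (onLine X L).card := by
  rw [← sum_through, ← Finset.sum_add_distrib, mul_comm, ← smul_eq_mul, ← Finset.sum_const]
  exact Finset.sum_congr rfl fun P hP => Nat.sub_add_cancel (h P hP)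

/-! ### Incidence combinatorics of a configuration -/

/-- The line through two points. -/
theorem exists_line_through {P Q : Plane K} (h : P ≠ Q) :
    ∃ M : Line K, P ∈ M.points ∧ Q ∈ M.points ∧
      ∀ L : Line K, P ∈ L.points → Q ∈ L.points → L = M := by
  have hli : LinearIndependent K ![P.rep, Q.rep] := by
    rw [LinearIndependent.pair_iff' P.rep_nonzero]
    intro a ha
    exact h (eq_of_rep_eq_smul (a := 1) (one_smul K P.rep).symm ha.symm)
  have hf : Module.finrank K (Submodule.span K (Set.range ![P.rep, Q.rep])) = 2 := by
    simpa using finrank_span_eq_card hli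
  refine ⟨⟨_, hf⟩, mem_points_iff.mpr (Submodule.subset_span ⟨0, rfl⟩),
    mem_points_iff.mpr (Submodule.subset_span ⟨1, rfl⟩), fun L hP hQ => ?_⟩
  refine Subtype.ext (Submodule.eq_of_le_of_finrank_eq ?_ (by rw [hf, L.2])).symm
  rw [Submodule.span_le]
  rintro _ ⟨i, rfl⟩
  fin_cases i
  · exact mem_points_iff.mp hP
  · exact mem_points_iff.mp hQ

theorem line_eq_of_mem {P Q : Plane K} (h : P ≠ Q) {L M : Line K} (hPL : P ∈ L.points)
    (hQL : Q ∈ L.points) (hPM : P ∈ M.points) (hQM : Q ∈ M.points) : L = M := by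
  obtain ⟨N, -, -, hN⟩ := exists_line_through h
  rw [hN L hPL hQL, hN M hPM hQM]

theorem card_onLine_onLine_le_one (X : Finset (Plane K)) {L M : Line K} (h : L ≠ M) :
    (onLine (onLine X L) M).card ≤ 1 := by
  rw [Finset.card_le_one]
  intro P hP Q hQ
  by_contra hne
  simp only [mem_onLine] at hP hQ
  exact h (line_eq_of_mem hne hP.1.2 hQ.1.2 hP.2 hQ.2)

open scoped Classical

/-- The data of a `𝕜`-configuration: `Y i` consists of `d i` points on the line `L i`. -/
structure ConfigData (X : Finset (Plane K)) {s : ℕ} (d : Fin s → ℕ)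
    (Y : Fin s → Finset (Plane K)) (L : Fin s → Line K) : Prop where
  mono : StrictMono d
  inj : Function.Injective L
  cover : ∀ P, P ∈ X ↔ ∃ i, P ∈ Y i
  card : ∀ i, (Y i).card = d i
  sub : ∀ i, ∀ P ∈ Y i, P ∈ (L i).points
  sep : ∀ i j, j < i → ∀ P ∈ Y j, P ∉ (L i).points

/-- The function `d j - j` is nondecreasing, here written without subtraction. -/
theorem strictMono_add_le {s : ℕ} {d : Fin s → ℕ} (hd : StrictMono d) (i j : Fin s)
    (hij : i ≤ j) : d i + j ≤ d j + i := by
  obtain ⟨j, hj⟩ := j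
  induction j with
  | zero =>
    have : i = ⟨0, hj⟩ := le_antisymm hij (Fin.mk_le_of_le_val (Nat.zero_le _))
    rw [this]
  | succ j ih =>
    rcases eq_or_lt_of_le hij with h | h
    · rw [h]
    · have h1 : i ≤ ⟨j, by omega⟩ := Fin.mk_le_of_le_val (Nat.lt_succ_iff.mp h)
      have h2 := ih (by omega) h1
      have h3 : d ⟨j, by omega⟩ < d ⟨j + 1, hj⟩ := hd (by simp)
      simp only at h2 ⊢
      omega

namespace ConfigData

variable {X : Finset (Plane K)} {s : ℕ} {d : Fin s → ℕ} {Y : Fin s → Finset (Plane K)}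
  {L : Fin s → Line K}

theorem le_of_mem_points (h : ConfigData X d Y L) {P : Plane K} {a j : Fin s} (hP : P ∈ Y j)
    (hPL : P ∈ (L a).points) : a ≤ j := by
  by_contra hlt
  exact h.sep a j (not_le.mp hlt) P hP hPL

theorem index_unique (h : ConfigData X d Y L) {P : Plane K} {i j : Fin s} (hi : P ∈ Y i)
    (hj : P ∈ Y j) : i = j :=
  le_antisymm (h.le_of_mem_points hj (h.sub i P hi)) (h.le_of_mem_points hi (h.sub j P hj))

theorem card_onLine_le_one (h : ConfigData X d Y L) {M : Line K} {j : Fin s} (hM : M ≠ L j) :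
    (onLine (Y j) M).card ≤ 1 := by
  rw [Finset.card_le_one]
  intro P hP Q hQ
  by_contra hne
  rw [mem_onLine] at hP hQ
  exact hM (line_eq_of_mem hne hP.2 hQ.2 (h.sub j P hP.1) (h.sub j Q hQ.1))

theorem card_onLine_eq_sum (h : ConfigData X d Y L) (M : Line K) :
    (onLine X M).card = ∑ j, (onLine (Y j) M).card := by
  rw [← Finset.card_biUnion]
  · congr 1
    ext P
    simp only [mem_onLine, Finset.mem_biUnion, Finset.mem_univ, true_and, h.cover]
    constructor
    · rintro ⟨⟨i, hi⟩, hM⟩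
      exact ⟨i, hi, hM⟩
    · rintro ⟨i, hi, hM⟩
      exact ⟨⟨i, hi⟩, hM⟩
  · intro i _ j _ hij
    rw [Function.onFun, Finset.disjoint_left]
    intro P hi hj
    exact hij (h.index_unique (mem_onLine.mp hi).1 (mem_onLine.mp hj).1)

/-- The later indices `j` such that `L a` contains no point of `Y j`. -/
noncomputable def missing (Y : Fin s → Finset (Plane K)) (L : Fin s → Line K) (a : Fin s) :
    Finset (Fin s) :=
  (Finset.Ioi a).filter fun j => onLine (Y j) (L a) = ∅

/-- `L a` contains all of `Y a`, nothing of the earlier sets, and at most one point of each of the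
`s - 1 - a` later ones. -/
theorem card_onLine_add (h : ConfigData X d Y L) (a : Fin s) :
    (onLine X (L a)).card + (missing Y L a).card + (a + 1) = d a + s := by
  have hself : onLine (Y a) (L a) = Y a := by
    ext P
    rw [mem_onLine, and_iff_left_iff_imp]
    exact h.sub a P
  have hterm : ∀ j, (onLine (Y j) (L a)).card + (if j ∈ missing Y L a then 1 else 0) =
      (if j = a then d a else 0) + (if j ∈ Finset.Ioi a then 1 else 0) := by
    intro j
    rcases lt_trichotomy j a with hj | rfl | hj
    · have h0 : onLine (Y j) (L a) = ∅ := by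
        rw [Finset.eq_empty_iff_forall_notMem]
        intro P hP
        rw [mem_onLine] at hP
        exact h.sep a j hj P hP.1 hP.2
      simp [missing, h0, hj.ne]
    · simp [missing, hself, h.card]
    · have h1 := h.card_onLine_le_one (M := L a) (j := j) (fun e => hj.ne (h.inj e))
      by_cases h0 : onLine (Y j) (L a) = ∅
      · simp [missing, h0, hj, hj.ne']
      · have := Finset.card_pos.mpr (Finset.nonempty_iff_ne_empty.mpr h0)
        simp only [missing, Finset.mem_filter, Finset.mem_Ioi, hj, h0, hj.ne']
        simp
        omega
  have hsum := Finset.sum_congr rfl fun j (_ : j ∈ (Finset.univ : Finset (Fin s))) => hterm j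
  rw [Finset.sum_add_distrib, Finset.sum_add_distrib, ← h.card_onLine_eq_sum] at hsum
  simp only [Finset.sum_ite_eq', Finset.mem_univ, if_true, Finset.sum_boole, Nat.cast_id,
    Finset.filter_mem_eq_inter, Finset.univ_inter, Fin.card_Ioi] at hsum
  have := a.2
  omega

theorem card_onLine_of_notMem_range (h : ConfigData X d Y L) {M : Line K}
    (hM : M ∉ Set.range L) :
    (onLine X M).card + (Finset.univ.filter fun j => onLine (Y j) M = ∅).card = s := by
  rw [h.card_onLine_eq_sum, Finset.card_filter, ← Finset.sum_add_distrib]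
  have : ∀ j ∈ (Finset.univ : Finset (Fin s)),
      (onLine (Y j) M).card + (if onLine (Y j) M = ∅ then 1 else 0) = 1 := by
    intro j _
    have h1 := h.card_onLine_le_one (M := M) (j := j) fun e => hM ⟨j, e.symm⟩
    by_cases h0 : onLine (Y j) M = ∅
    · simp [h0]
    · have := Finset.card_pos.mpr (Finset.nonempty_iff_ne_empty.mpr h0)
      rw [if_neg h0]
      omega
  rw [Finset.sum_congr rfl this]
  simp

theorem add_le_top (h : ConfigData X d Y L) (hs : 0 < s) (a : Fin s) :
    d a + s ≤ d ⟨s - 1, Nat.sub_lt hs Nat.one_pos⟩ + (a + 1) := by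
  have := strictMono_add_le h.mono a ⟨s - 1, Nat.sub_lt hs Nat.one_pos⟩
    (Fin.le_def.mpr (Nat.le_sub_one_of_lt a.2))
  simp only at this
  omega

theorem le_top (h : ConfigData X d Y L) (hs : 0 < s) (hd : ∀ i, 1 ≤ d i) :
    s ≤ d ⟨s - 1, Nat.sub_lt hs Nat.one_pos⟩ := by
  have := h.add_le_top hs ⟨0, hs⟩
  have := hd ⟨0, hs⟩
  simp only at *
  omega

theorem card_onLine_le_top (h : ConfigData X d Y L) (hs : 0 < s) (hd : ∀ i, 1 ≤ d i)
    (M : Line K) : (onLine X M).card ≤ d ⟨s - 1, Nat.sub_lt hs Nat.one_pos⟩ := by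
  by_cases hM : M ∈ Set.range L
  · obtain ⟨a, rfl⟩ := hM
    have := h.card_onLine_add a
    have := h.add_le_top hs a
    omega
  · have := h.card_onLine_of_notMem_range hM
    have := h.le_top hs hd
    omega

theorem card_onLine_last (h : ConfigData X d Y L) (hs : 0 < s) (hd : ∀ i, 1 ≤ d i) :
    (onLine X (L ⟨s - 1, Nat.sub_lt hs Nat.one_pos⟩)).card =
      d ⟨s - 1, Nat.sub_lt hs Nat.one_pos⟩ := by
  refine le_antisymm (h.card_onLine_le_top hs hd _) ?_
  rw [← h.card]
  refine Finset.card_le_card fun P hP => mem_onLine.mpr ⟨(h.cover P).mpr ⟨_, hP⟩, h.sub _ P hP⟩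

/-- A line of the configuration with the maximal number of points meets all later `Y j`. -/
theorem exists_mem_of_full (h : ConfigData X d Y L) (hs : 0 < s) {a : Fin s}
    (ha : (onLine X (L a)).card = d ⟨s - 1, Nat.sub_lt hs Nat.one_pos⟩) {j : Fin s}
    (hj : a < j) : ∃ P ∈ Y j, P ∈ (L a).points := by
  have h1 := h.card_onLine_add a
  have h2 := h.add_le_top hs a
  -- Being full is equality in the bound `d a + (s - 1 - a) ≤ d_s`, which leaves no missing index.
  have h3 : missing Y L a = ∅ := Finset.card_eq_zero.mp (by omega)
  by_contra! h4
  have : j ∈ missing Y L a := by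
    rw [missing, Finset.mem_filter, Finset.mem_Ioi]
    refine ⟨hj, Finset.eq_empty_iff_forall_notMem.mpr fun P hP => ?_⟩
    exact h4 P (mem_onLine.mp hP).1 (mem_onLine.mp hP).2
  rw [h3] at this
  exact absurd this (Finset.notMem_empty _)

/-- A further line with the maximal number of points meets all `Y j`. -/
theorem exists_mem_of_full_of_notMem_range (h : ConfigData X d Y L) (hs : 0 < s)
    (hd : ∀ i, 1 ≤ d i) {M : Line K} (hM : M ∉ Set.range L)
    (hc : (onLine X M).card = d ⟨s - 1, Nat.sub_lt hs Nat.one_pos⟩) :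
    d ⟨s - 1, Nat.sub_lt hs Nat.one_pos⟩ = s ∧ ∀ j, ∃ P ∈ Y j, P ∈ M.points := by
  have h1 := h.card_onLine_of_notMem_range hM
  have h2 := h.le_top hs hd
  refine ⟨by omega, fun j => ?_⟩
  have h3 : (Finset.univ.filter fun j => onLine (Y j) M = ∅) = ∅ :=
    Finset.card_eq_zero.mp (by omega)
  by_contra! h4
  have : j ∈ (Finset.univ.filter fun j => onLine (Y j) M = ∅) := by
    rw [Finset.mem_filter]
    refine ⟨Finset.mem_univ _, Finset.eq_empty_iff_forall_notMem.mpr fun P hP => ?_⟩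
    exact h4 P (mem_onLine.mp hP).1 (mem_onLine.mp hP).2
  rw [h3] at this
  exact absurd this (Finset.notMem_empty _)

/-- Two lines with the maximal number of points meet in a point of `X`. -/
theorem card_inter_full (h : ConfigData X d Y L) (hs : 0 < s) (hd : ∀ i, 1 ≤ d i)
    {M N : Line K} (hMN : M ≠ N)
    (hM : (onLine X M).card = d ⟨s - 1, Nat.sub_lt hs Nat.one_pos⟩)
    (hN : (onLine X N).card = d ⟨s - 1, Nat.sub_lt hs Nat.one_pos⟩) :
    (onLine (onLine X M) N).card = 1 := by
  refine le_antisymm (card_onLine_onLine_le_one X hMN) (Finset.card_pos.mpr ?_)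
  suffices ∃ j, ∃ P ∈ Y j, P ∈ M.points ∧ P ∈ N.points by
    obtain ⟨j, P, hP, h1, h2⟩ := this
    exact ⟨P, mem_onLine.mpr ⟨mem_onLine.mpr ⟨(h.cover P).mpr ⟨j, hP⟩, h1⟩, h2⟩⟩
  by_cases hMr : M ∈ Set.range L
  · obtain ⟨a, rfl⟩ := hMr
    by_cases hNr : N ∈ Set.range L
    · obtain ⟨b, rfl⟩ := hNr
      rcases lt_or_gt_of_ne (fun e => hMN (by rw [e]) : a ≠ b) with hab | hab
      · obtain ⟨P, hP, hPM⟩ := h.exists_mem_of_full hs hM hab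
        exact ⟨b, P, hP, hPM, h.sub b P hP⟩
      · obtain ⟨P, hP, hPM⟩ := h.exists_mem_of_full hs hN hab
        exact ⟨a, P, hP, h.sub a P hP, hPM⟩
    · obtain ⟨P, hP, hPN⟩ := (h.exists_mem_of_full_of_notMem_range hs hd hNr hN).2 a
      exact ⟨a, P, hP, h.sub a P hP, hPN⟩
  · obtain ⟨htop, hMj⟩ := h.exists_mem_of_full_of_notMem_range hs hd hMr hM
    by_cases hNr : N ∈ Set.range L
    · obtain ⟨b, rfl⟩ := hNr
      obtain ⟨P, hP, hPM⟩ := hMj b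
      exact ⟨b, P, hP, hPM, h.sub b P hP⟩
    · obtain ⟨P, hP, hPM⟩ := hMj ⟨0, hs⟩
      obtain ⟨Q, hQ, hQN⟩ := (h.exists_mem_of_full_of_notMem_range hs hd hNr hN).2 ⟨0, hs⟩
      -- Here `d_s = s` forces the first set to be a single point, through which both lines pass.
      have h1 := h.add_le_top hs ⟨0, hs⟩
      have hc : (Y ⟨0, hs⟩).card ≤ 1 := by rw [h.card]; simp only at h1; omega
      rw [Finset.card_le_one.mp hc Q hQ P hP] at hQN
      exact ⟨_, P, hP, hPM, hQN⟩

/-! ### Peeling in decreasing order, and peeling the full lines -/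

/-- The lines `L j` with `b ≤ j`, in decreasing order. -/
noncomputable def descending (L : Fin s → Line K) (b : ℕ) : List (Line K) :=
  ((List.finRange s).reverse.filter fun j : Fin s => decide (b ≤ (j : ℕ))).map L

theorem mem_descending {b : ℕ} {M : Line K} :
    M ∈ descending L b ↔ ∃ j : Fin s, b ≤ (j : ℕ) ∧ L j = M := by
  simp [descending]

/-- Supplies the state needed by `defect_le_peel`: when `L a` is reached, exactly the `s - 1 - a`
later lines are gone, whatever the cutoff `b ≤ a`. -/
theorem descending_split {b : ℕ} {l₁ l₂ : List (Line K)} {M : Line K} (hinj : Function.Injective L)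
    (hl : descending L b = l₁ ++ M :: l₂) :
    ∃ a : Fin s, b ≤ (a : ℕ) ∧ M = L a ∧ l₁.Nodup ∧ l₁.length + (a + 1) = s ∧
      ∀ N, N ∈ l₁ ↔ ∃ j, a < j ∧ L j = N := by
  rw [descending, List.map_eq_append_iff] at hl
  obtain ⟨q₁, q', hq, rfl, hq'⟩ := hl
  rw [List.map_eq_cons_iff] at hq'
  obtain ⟨a, q₂, rfl, rfl, rfl⟩ := hq'
  have hmem : ∀ j : Fin s, j ∈ q₁ ++ a :: q₂ ↔ b ≤ (j : ℕ) := by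
    intro j
    rw [← hq]
    simp
  have hpw : (q₁ ++ a :: q₂).Pairwise (· > ·) := by
    rw [← hq]
    refine List.Pairwise.filter _ ?_
    rw [List.pairwise_reverse]
    exact List.pairwise_lt_finRange s
  rw [List.pairwise_append, List.pairwise_cons] at hpw
  obtain ⟨hp1, ⟨hp2, -⟩, hp3⟩ := hpw
  have hab : b ≤ (a : ℕ) := (hmem a).mp (by simp)
  have hq1 : ∀ j, j ∈ q₁ ↔ a < j := by
    intro j
    refine ⟨fun hj => hp3 j hj a (by simp), fun hj => ?_⟩
    have := (hmem j).mpr (hab.trans hj.le)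
    rw [List.mem_append, List.mem_cons] at this
    rcases this with h | rfl | h
    · exact h
    · exact absurd hj (lt_irrefl _)
    · exact absurd hj (hp2 j h).asymm
  have hnd : q₁.Nodup := hp1.imp fun h => h.ne'
  refine ⟨a, hab, rfl, hnd.map hinj, ?_, fun N => ?_⟩
  · have : q₁.toFinset = Finset.Ioi a := by
      ext j
      simp [hq1]
    rw [List.length_map, ← List.toFinset_card_of_nodup hnd, this, Fin.card_Ioi]
    have := a.2
    omega
  · simp [hq1]

theorem length_descending {b : ℕ} (hb : b ≤ s) : (descending L b).length = s - b := by
  have hnd : ((List.finRange s).reverse.filter fun j : Fin s => decide (b ≤ (j : ℕ))).Nodup :=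
    (List.nodup_reverse.mpr (List.nodup_finRange s)).filter _
  rw [descending, List.length_map, ← List.toFinset_card_of_nodup hnd]
  have h1 : ((List.finRange s).reverse.filter fun j : Fin s => decide (b ≤ (j : ℕ))).toFinset =
      Finset.univ.filter fun j : Fin s => ¬ (j : ℕ) < b := by
    ext j
    simp
  have h2 := Finset.card_filter_add_card_filter_not (s := (Finset.univ : Finset (Fin s)))
    (fun j : Fin s => (j : ℕ) < b)
  rw [Fin.card_filter_val_lt, Finset.card_univ, Fintype.card_fin, min_eq_right hb] at h2
  rw [h1]
  omega

/-- A fat point scheme with multiplicities at most `c` on a configuration imposes independent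
conditions in degrees at least `c * dₛ - 1`. -/
theorem defect_nonpos [Infinite K] (h : ConfigData X d Y L) (hs : 0 < s) (hd : ∀ i, 1 ≤ d i)
    (c : ℕ) : ∀ (n : ℕ) (μ : Plane K → ℕ), (∀ P ∈ X, μ P ≤ c) →
      c * d ⟨s - 1, Nat.sub_lt hs Nat.one_pos⟩ ≤ n → defect X μ n ≤ 0 := by
  have hst := h.le_top hs hd
  induction c with
  | zero =>
    intro n μ hμ _
    exact (defect_eq_zero_of_forall (fun P hP => Nat.le_zero.mp (hμ P hP)) n).le
  | succ c ih =>
    intro n μ hμ hn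
    rw [Nat.succ_mul] at hn
    have hlen : (descending L 0).length = s := by
      simpa using length_descending (L := L) (Nat.zero_le s)
    obtain ⟨n', rfl⟩ : ∃ n', n = n' + (descending L 0).length := ⟨n - s, by omega⟩
    refine (defect_le_peel _ ?_).trans (ih n' _ ?_ (by omega))
    · intro l₁ M l₂ hl
      obtain ⟨a, -, rfl, -, hl1, hmem⟩ := descending_split h.inj hl
      -- A point of `L a` outside `Y a` lies on a later line, already peeled. So the sum on `L a` is
      -- at most `c * d_s + d a`, which fits because `d a + (s - 1 - a) ≤ d_s`.
      have hle : ∀ P ∈ onLine X (L a), peel μ l₁ P ≤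
          c + (if P ∈ Y a then 1 else 0) := by
        intro P hP
        obtain ⟨hX, hPL⟩ := mem_onLine.mp hP
        have h1 := hμ P hX
        by_cases hPa : P ∈ Y a
        · rw [if_pos hPa, peel]; omega
        · obtain ⟨j, hj⟩ := (h.cover P).mp hX
          have haj : a < j := lt_of_le_of_ne (h.le_of_mem_points hj hPL)
            (fun e => hPa (by rw [e]; exact hj))
          have := through_pos ((hmem (L j)).mpr ⟨j, haj, rfl⟩) (h.sub j P hj)
          rw [peel]
          omega
      have h1 := Finset.sum_le_sum hle
      rw [Finset.sum_add_distrib, Finset.sum_const, Finset.sum_boole, Nat.cast_id,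
        smul_eq_mul] at h1
      have h2 : ((onLine X (L a)).filter (· ∈ Y a)).card ≤ d a := by
        rw [← h.card]
        exact Finset.card_le_card fun P hP => (Finset.mem_filter.mp hP).2
      have h3 := Nat.mul_le_mul_left c (h.card_onLine_le_top hs hd (L a))
      rw [mul_comm _ c] at h1
      have h4 := h.add_le_top hs a
      omega
    · intro P hP
      obtain ⟨j, hj⟩ := (h.cover P).mp hP
      have := through_pos (mem_descending.mpr ⟨j, Nat.zero_le _, rfl⟩) (h.sub j P hj)
      have := hμ P hP
      rw [peel]
      omega

/-- Peeling off all lines with the maximal number of points. -/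
theorem defect_eq_of_full [Infinite K] (h : ConfigData X d Y L) (hs : 0 < s) (hd : ∀ i, 1 ≤ d i)
    {l : List (Line K)} (hnd : l.Nodup)
    (hl : ∀ M ∈ l, (onLine X M).card = d ⟨s - 1, Nat.sub_lt hs Nat.one_pos⟩) {m n : ℕ}
    (hm : l.length ≤ m)
    (hn : n + l.length + 1 = m * d ⟨s - 1, Nat.sub_lt hs Nat.one_pos⟩) :
    defect X (fun _ => m) (n + l.length) = defect X (peel (fun _ => m) l) n + l.length := by
  refine defect_eq_peel l fun l₁ M l₂ hsplit => ?_
  subst hsplit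
  have hM := hl M (by simp)
  have h1 := sum_peel_const (X := X) (L := M) (l := l₁) (m := m) fun P _ =>
    (through_le_length l₁ P).trans (by simp only [List.length_append] at hm; omega)
  -- Each earlier full line lowers the sum on `M` by exactly one, in step with the degree, so the
  -- excess of one persists.
  have h2 : (l₁.map fun N => (onLine (onLine X M) N).card) = l₁.map fun _ => 1 := by
    refine List.map_congr_left fun N hN => ?_
    refine h.card_inter_full hs hd ?_ hM (hl N (by simp [hN]))
    rintro rfl
    rw [List.nodup_append] at hnd
    exact hnd.2.2 M hN M (by simp) rfl
  rw [h2, hM] at h1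
  simp only [List.map_const', List.sum_replicate, smul_eq_mul, mul_one] at h1
  omega

end ConfigData

/-! ### The case `d_s > s` -/

namespace ConfigData

variable {X : Finset (Plane K)} {s : ℕ} {d : Fin s → ℕ} {Y : Fin s → Finset (Plane K)}
  {L : Fin s → Line K}

/-- The lines with the maximal number of points when that number exceeds `s`. -/
theorem exists_full_of_lt [Infinite K] (h : ConfigData X d Y L) (hs : 0 < s) (hd : ∀ i, 1 ≤ d i)
    (htop : s < d ⟨s - 1, Nat.sub_lt hs Nat.one_pos⟩) {m : ℕ} (hm : s + 1 ≤ m) :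
    ∃ D : Finset (Line K),
      (∀ M, M ∈ D ↔ (onLine X M).card = d ⟨s - 1, Nat.sub_lt hs Nat.one_pos⟩) ∧ D.card ≤ m ∧
      ∃ n, n + D.card + 1 = m * d ⟨s - 1, Nat.sub_lt hs Nat.one_pos⟩ ∧
        defect X (peel (fun _ => m) D.toList) n ≤ 0 := by
  generalize htop' : d ⟨s - 1, Nat.sub_lt hs Nat.one_pos⟩ = top at htop
  set A : Finset (Line K) := Finset.univ.image L with hA
  set D := A.filter fun M => (onLine X M).card = top with hD
  have hAc : A.card = s := by
    rw [hA, Finset.card_image_of_injective _ h.inj, Finset.card_univ, Fintype.card_fin]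
  have hDA : D ⊆ A := Finset.filter_subset _ _
  have hsd : (A \ D).card + D.card = s := by
    rw [Finset.card_sdiff_add_card_eq_card hDA, hAc]
  obtain ⟨m', rfl⟩ : ∃ m', m = m' + 1 := ⟨m - 1, by omega⟩
  have hmul : (m' + 1) * top = m' * top + top := Nat.succ_mul _ _
  -- The second summand is spent on the remaining `L i`; the first is at least `m' * top` because `s
  -- < top`, as `defect_nonpos` requires.
  refine ⟨D, fun M => ?_, by omega, (m' * top + top - 1 - s) + (A \ D).toList.length, ?_, ?_⟩
  · rw [hD, Finset.mem_filter, and_iff_right_iff_imp]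
    intro hM
    by_contra hMA
    have := (h.exists_mem_of_full_of_notMem_range hs hd (M := M) (fun hr => hMA ?_)
      (hM.trans htop'.symm)).1
    · omega
    · obtain ⟨i, rfl⟩ := hr
      exact Finset.mem_image_of_mem _ (Finset.mem_univ _)
  · rw [Finset.length_toList]
    omega
  · refine (defect_le_peel _ fun l₁ M l₂ hl => ?_).trans
      (h.defect_nonpos hs hd m' _ _ (fun P hP => ?_) (by rw [htop']; omega))
    · have hlen := congrArg List.length hl
      simp only [List.length_append, List.length_cons, Finset.length_toList] at hlen
      have hM : M ∈ A \ D := by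
        rw [← Finset.mem_toList, hl]
        simp
      have hc := h.card_onLine_le_top hs hd M
      have hne : (onLine X M).card ≠ top := fun e => (Finset.mem_sdiff.mp hM).2
        (Finset.mem_filter.mpr ⟨(Finset.mem_sdiff.mp hM).1, e⟩)
      have hsum : ∑ P ∈ onLine X M, peel (peel (fun _ => m' + 1) D.toList) l₁ P ≤
          (onLine X M).card * (m' + 1) := by
        rw [← smul_eq_mul]
        refine Finset.sum_le_card_nsmul _ _ _ fun P _ => ?_
        simp only [peel]
        omega
      -- A line that is not full misses at least one point, saving a whole `m`; this exceeds the
      -- loss of degree from peeling at most `s` lines.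
      have hle : (onLine X M).card * (m' + 1) ≤ (top - 1) * (m' + 1) :=
        Nat.mul_le_mul_right _ (by omega)
      have hmul2 : (top - 1) * (m' + 1) + (m' + 1) = m' * top + top := by
        obtain ⟨k, rfl⟩ : ∃ k, top = k + 1 := ⟨top - 1, by omega⟩
        simp only [Nat.add_sub_cancel]
        ring
      rw [Finset.length_toList]
      omega
    · obtain ⟨j, hj⟩ := (h.cover P).mp hP
      have hLA : L j ∈ A := Finset.mem_image_of_mem _ (Finset.mem_univ _)
      have hPL := h.sub j P hj
      rw [← peel_append, peel, through_append]
      by_cases hLD : L j ∈ D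
      · have := through_pos (Finset.mem_toList.mpr hLD) hPL
        omega
      · have := through_pos (Finset.mem_toList.mpr (Finset.mem_sdiff.mpr ⟨hLA, hLD⟩)) hPL
        omega

theorem through_toList (A : Finset (Line K)) (P : Plane K) :
    through A.toList P = (A.filter fun M => P ∈ M.points).card := by
  rw [through, Finset.card_filter, ← Finset.sum_map_toList]
  induction A.toList with
  | nil => rfl
  | cons M l ih =>
    rw [List.countP_cons, ih, List.map_cons, List.sum_cons, add_comm]
    simp

/-- The number of lines of `l` not meeting `L a` in a point of `X` is at most the number of
missing indices. -/
theorem length_le_add_missing {a : Fin s} {l : List (Line K)} (hnd : l.Nodup)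
    (hl : ∀ M ∈ l, onLine (onLine X (L a)) M = ∅ → ∃ j ∈ missing Y L a, L j = M) :
    l.length ≤ (l.map fun M => (onLine (onLine X (L a)) M).card).sum + (missing Y L a).card := by
  have h1 : ∀ l : List (Line K), l.length ≤
      (l.map fun M => (onLine (onLine X (L a)) M).card).sum +
        (l.filter fun M => decide (onLine (onLine X (L a)) M = ∅)).length := by
    intro l
    induction l with
    | nil => simp
    | cons M l ih =>
      rw [List.length_cons, List.map_cons, List.sum_cons, List.filter_cons]
      by_cases h0 : onLine (onLine X (L a)) M = ∅
      · simp only [h0, decide_true, if_true, List.length_cons]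
        omega
      · have := Finset.card_pos.mpr (Finset.nonempty_iff_ne_empty.mpr h0)
        simp only [h0, decide_false]
        simp only [Bool.false_eq_true, if_false]
        omega
  refine (h1 l).trans (Nat.add_le_add_left ?_ _)
  rw [← List.toFinset_card_of_nodup (hnd.filter _)]
  refine (Finset.card_le_card (t := (missing Y L a).image L) fun M hM => ?_).trans
    Finset.card_image_le
  rw [List.mem_toFinset, List.mem_filter, decide_eq_true_eq] at hM
  obtain ⟨j, hj, rfl⟩ := hl M hM.1 hM.2
  exact Finset.mem_image_of_mem _ hj

theorem mem_missing_of_empty (h : ConfigData X d Y L) {a j : Fin s} (haj : a < j)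
    (he : onLine (onLine X (L a)) (L j) = ∅) : j ∈ missing Y L a := by
  rw [missing, Finset.mem_filter, Finset.mem_Ioi]
  refine ⟨haj, Finset.eq_empty_iff_forall_notMem.mpr fun P hP => ?_⟩
  rw [mem_onLine] at hP
  have : P ∈ onLine (onLine X (L a)) (L j) :=
    mem_onLine.mpr ⟨mem_onLine.mpr ⟨(h.cover P).mpr ⟨j, hP.1⟩, hP.2⟩, h.sub j P hP.1⟩
  rw [he] at this
  exact absurd this (Finset.notMem_empty _)

end ConfigData

/-! ### The case of type `(1, 2, …, s)` -/

/-- A configuration of type `(1, 2, …, s)` whose first line joins the point `P` of `Y 0` to the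
point `A` of `Y 1 = {A, B}`, together with the line `H` joining `P` to `B`. -/
structure StaircaseData (X : Finset (Plane K)) (s : ℕ) (Y : Fin s → Finset (Plane K))
    (L : Fin s → Line K) (i₀ i₁ : Fin s) (P A B : Plane K) (H : Line K) : Prop where
  config : ConfigData X (fun i : Fin s => (i : ℕ) + 1) Y L
  val_zero : (i₀ : ℕ) = 0
  val_one : (i₁ : ℕ) = 1
  Y_zero : Y i₀ = {P}
  Y_one : Y i₁ = {A, B}
  ne : A ≠ B
  A_mem : A ∈ (L i₀).points
  P_mem : P ∈ H.points
  B_mem : B ∈ H.points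

namespace StaircaseData

variable {X : Finset (Plane K)} {s : ℕ} {Y : Fin s → Finset (Plane K)}
  {L : Fin s → Line K} {i₀ i₁ : Fin s} {P A B : Plane K} {H : Line K}

theorem P_mem_Y (h : StaircaseData X s Y L i₀ i₁ P A B H) : P ∈ Y i₀ := by simp [h.Y_zero]

theorem A_mem_Y (h : StaircaseData X s Y L i₀ i₁ P A B H) : A ∈ Y i₁ := by simp [h.Y_one]

theorem B_mem_Y (h : StaircaseData X s Y L i₀ i₁ P A B H) : B ∈ Y i₁ := by simp [h.Y_one]

theorem index_ne (h : StaircaseData X s Y L i₀ i₁ P A B H) : i₀ ≠ i₁ := by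
  intro e
  have := h.val_zero
  rw [e, h.val_one] at this
  omega

theorem P_ne_A (h : StaircaseData X s Y L i₀ i₁ P A B H) : P ≠ A := by
  rintro rfl
  exact h.index_ne (h.config.index_unique h.P_mem_Y h.A_mem_Y)

theorem P_ne_B (h : StaircaseData X s Y L i₀ i₁ P A B H) : P ≠ B := by
  rintro rfl
  exact h.index_ne (h.config.index_unique h.P_mem_Y h.B_mem_Y)

theorem B_notMem (h : StaircaseData X s Y L i₀ i₁ P A B H) : B ∉ (L i₀).points := fun hB =>
  h.index_ne (h.config.inj (line_eq_of_mem h.ne h.A_mem hB (h.config.sub i₁ A h.A_mem_Y)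
    (h.config.sub i₁ B h.B_mem_Y)))

theorem H_notMem_range (h : StaircaseData X s Y L i₀ i₁ P A B H) : H ∉ Set.range L := by
  rintro ⟨a, rfl⟩
  have h1 := h.config.le_of_mem_points h.P_mem_Y h.P_mem
  have h2 : a = i₀ := Fin.ext (by have := Fin.le_def.mp h1; have := h.val_zero; omega)
  subst h2
  exact h.B_notMem h.B_mem

theorem two_le (h : StaircaseData X s Y L i₀ i₁ P A B H) : 2 ≤ s := by
  have := i₁.2
  have := h.val_one
  omega

theorem pos (h : StaircaseData X s Y L i₀ i₁ P A B H) : 0 < s := two_pos.trans_le h.two_le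

theorem eq_or_eq_or_eq (h : StaircaseData X s Y L i₀ i₁ P A B H) {Q : Plane K} {j : Fin s}
    (hQ : Q ∈ Y j) (hj : (j : ℕ) < 2) : Q = P ∨ Q = A ∨ Q = B := by
  have h0 := h.val_zero
  have h1 := h.val_one
  rcases (by omega : (j : ℕ) = 0 ∨ (j : ℕ) = 1) with hj | hj
  · rw [show j = i₀ from Fin.ext (by omega), h.Y_zero, Finset.mem_singleton] at hQ
    exact Or.inl hQ
  · rw [show j = i₁ from Fin.ext (by omega), h.Y_one, Finset.mem_insert,
      Finset.mem_singleton] at hQ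
    exact Or.inr hQ

theorem top_eq (hs : 0 < s) :
    (fun i : Fin s => (i : ℕ) + 1) ⟨s - 1, Nat.sub_lt hs Nat.one_pos⟩ = s := by
  simp only
  omega

theorem card_le (h : StaircaseData X s Y L i₀ i₁ P A B H) (M : Line K) :
    (onLine X M).card ≤ s :=
  (h.config.card_onLine_le_top h.pos (fun _ => Nat.succ_pos _) M).trans (top_eq h.pos).le

theorem card_add_missing (h : StaircaseData X s Y L i₀ i₁ P A B H) (a : Fin s) :
    (onLine X (L a)).card + (ConfigData.missing Y L a).card = s := by
  have := h.config.card_onLine_add a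
  omega

theorem exists_mem_of_full (h : StaircaseData X s Y L i₀ i₁ P A B H) {a j : Fin s}
    (ha : (onLine X (L a)).card = s) (hj : a < j) : ∃ Q ∈ Y j, Q ∈ (L a).points :=
  h.config.exists_mem_of_full h.pos (ha.trans (top_eq h.pos).symm) hj

theorem exists_mem_of_full_of_notMem_range (h : StaircaseData X s Y L i₀ i₁ P A B H) {M : Line K}
    (hM : M ∉ Set.range L) (hc : (onLine X M).card = s) (j : Fin s) :
    ∃ Q ∈ Y j, Q ∈ M.points :=
  (h.config.exists_mem_of_full_of_notMem_range h.pos (fun _ => Nat.succ_pos _) hM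
    (hc.trans (top_eq h.pos).symm)).2 j

/-- Such a line passes through `P` and through `A` or `B`; the join of `P` and `A` is `L i₀` by the
normalization. -/
theorem eq_of_full_of_notMem_range (h : StaircaseData X s Y L i₀ i₁ P A B H) {M : Line K}
    (hM : M ∉ Set.range L) (hc : (onLine X M).card = s) : M = H := by
  obtain ⟨Q, hQ, hQM⟩ := h.exists_mem_of_full_of_notMem_range hM hc i₀
  obtain ⟨R, hR, hRM⟩ := h.exists_mem_of_full_of_notMem_range hM hc i₁
  rw [h.Y_zero, Finset.mem_singleton] at hQ
  rw [h.Y_one, Finset.mem_insert, Finset.mem_singleton] at hR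
  subst hQ
  rcases hR with rfl | rfl
  · exact absurd ⟨i₀, line_eq_of_mem h.P_ne_A (h.config.sub i₀ Q h.P_mem_Y) h.A_mem hQM hRM⟩ hM
  · exact line_eq_of_mem h.P_ne_B hQM hRM h.P_mem h.B_mem

/-- The lines of the configuration together with `H`. -/
noncomputable def allLines (L : Fin s → Line K) (H : Line K) : Finset (Line K) :=
  insert H (Finset.univ.image L)

/-- The lines containing `s` points. -/
noncomputable def fullLines (X : Finset (Plane K)) (L : Fin s → Line K) (H : Line K) :
    Finset (Line K) :=
  (allLines L H).filter fun M => (onLine X M).card = s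

theorem L_mem_allLines (a : Fin s) : L a ∈ allLines L H :=
  Finset.mem_insert_of_mem (Finset.mem_image_of_mem _ (Finset.mem_univ _))

theorem H_mem_allLines : H ∈ allLines L H := Finset.mem_insert_self _ _

theorem card_allLines (h : StaircaseData X s Y L i₀ i₁ P A B H) :
    (allLines L H).card = s + 1 := by
  rw [allLines, Finset.card_insert_of_notMem, Finset.card_image_of_injective _ h.config.inj,
    Finset.card_univ, Fintype.card_fin]
  intro hH
  obtain ⟨a, -, ha⟩ := Finset.mem_image.mp hH
  exact h.H_notMem_range ⟨a, ha⟩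

theorem mem_fullLines (h : StaircaseData X s Y L i₀ i₁ P A B H) {M : Line K} :
    M ∈ fullLines X L H ↔ (onLine X M).card = s := by
  rw [fullLines, Finset.mem_filter, and_iff_right_iff_imp]
  intro hc
  by_cases hM : M ∈ Set.range L
  · obtain ⟨a, rfl⟩ := hM
    exact L_mem_allLines a
  · rw [h.eq_of_full_of_notMem_range hM hc]
    exact H_mem_allLines

theorem card_inter_full (h : StaircaseData X s Y L i₀ i₁ P A B H) {M N : Line K} (hMN : M ≠ N)
    (hM : M ∈ fullLines X L H) (hN : N ∈ fullLines X L H) :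
    (onLine (onLine X M) N).card = 1 :=
  h.config.card_inter_full h.pos (fun _ => Nat.succ_pos _) hMN
    ((h.mem_fullLines.mp hM).trans (top_eq h.pos).symm)
    ((h.mem_fullLines.mp hN).trans (top_eq h.pos).symm)

/-- A full line and a line `L b` of the configuration, other than the one indexed by `j`, do not
meet in `Y j`, provided the full line also meets `Y b`. -/
theorem not_concurrent (h : StaircaseData X s Y L i₀ i₁ P A B H) {Q : Plane K} {b j : Fin s}
    {M : Line K} (hQ : Q ∈ Y j) (hbj : b ≠ j) (hQM : Q ∈ M.points) (hQb : Q ∈ (L b).points)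
    (hM : M ≠ L b) (hb : ∃ R ∈ Y b, R ∈ M.points) : False := by
  obtain ⟨R, hR, hRM⟩ := hb
  by_cases hRQ : R = Q
  · subst hRQ
    exact hbj (h.config.index_unique hR hQ)
  · exact hM (line_eq_of_mem hRQ hRM hQM (h.config.sub b R hR) hQb)

/-- No three full lines are concurrent in a point of `X`. -/
theorem through_fullLines_le (h : StaircaseData X s Y L i₀ i₁ P A B H) {Q : Plane K}
    (hQ : Q ∈ X) : through (fullLines X L H).toList Q ≤ 2 := by
  obtain ⟨j, hj⟩ := (h.config.cover Q).mp hQ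
  rw [ConfigData.through_toList]
  set S := (fullLines X L H).filter fun M => Q ∈ M.points with hS
  -- Of two further full lines through `Q`, one would meet the set `Y b` of the other, `L b`, in a
  -- second common point; at most one lies outside the configuration.
  have h1 : (S.erase (L j)).card ≤ 1 := by
    rw [Finset.card_le_one]
    intro M hM N hN
    by_contra hne
    rw [Finset.mem_erase, hS, Finset.mem_filter, h.mem_fullLines] at hM hN
    obtain ⟨hMj, hMc, hQM⟩ := hM
    obtain ⟨hNj, hNc, hQN⟩ := hN
    by_cases hMr : M ∈ Set.range L
    · obtain ⟨a, rfl⟩ := hMr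
      have haj : a ≠ j := fun e => hMj (by rw [e])
      by_cases hNr : N ∈ Set.range L
      · obtain ⟨b, rfl⟩ := hNr
        have hbj : b ≠ j := fun e => hNj (by rw [e])
        rcases lt_or_gt_of_ne (fun e => hne (by rw [e]) : a ≠ b) with hab | hab
        · exact h.not_concurrent hj hbj hQM hQN hne (h.exists_mem_of_full hMc hab)
        · exact h.not_concurrent hj haj hQN hQM (Ne.symm hne) (h.exists_mem_of_full hNc hab)
      · exact h.not_concurrent hj haj hQN hQM (Ne.symm hne)
          (h.exists_mem_of_full_of_notMem_range hNr hNc a)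
    · by_cases hNr : N ∈ Set.range L
      · obtain ⟨b, rfl⟩ := hNr
        have hbj : b ≠ j := fun e => hNj (by rw [e])
        exact h.not_concurrent hj hbj hQM hQN hne
          (h.exists_mem_of_full_of_notMem_range hMr hMc b)
      · exact hne ((h.eq_of_full_of_notMem_range hMr hMc).trans
          (h.eq_of_full_of_notMem_range hNr hNc).symm)
  have h2 := Finset.pred_card_le_card_erase (s := S) (a := L j)
  omega

/-- A full line sharing no point of `X` with `L a` must be some `L b` with `a < b`: full lines
outside the configuration and full lines of smaller index both meet `Y a`. -/
theorem length_fullLines_le (h : StaircaseData X s Y L i₀ i₁ P A B H) (a : Fin s) :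
    (fullLines X L H).card ≤
      ((fullLines X L H).toList.map fun M => (onLine (onLine X (L a)) M).card).sum +
        (ConfigData.missing Y L a).card := by
  rw [← Finset.length_toList]
  refine ConfigData.length_le_add_missing (Finset.nodup_toList _) fun M hM he => ?_
  rw [Finset.mem_toList, h.mem_fullLines] at hM
  have hmeet : ¬ ∃ Q ∈ X, Q ∈ (L a).points ∧ Q ∈ M.points := by
    rintro ⟨Q, hQ, hQa, hQM⟩
    have : Q ∈ onLine (onLine X (L a)) M := mem_onLine.mpr ⟨mem_onLine.mpr ⟨hQ, hQa⟩, hQM⟩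
    rw [he] at this
    exact absurd this (Finset.notMem_empty _)
  by_cases hMr : M ∈ Set.range L
  · obtain ⟨b, rfl⟩ := hMr
    refine ⟨b, ?_, rfl⟩
    rcases lt_trichotomy a b with hab | rfl | hab
    · exact h.config.mem_missing_of_empty hab he
    · obtain ⟨Q, hQ⟩ := Finset.card_pos.mp (by rw [h.config.card]; omega : 0 < (Y a).card)
      have := h.config.sub a Q hQ
      exact absurd ⟨Q, (h.config.cover Q).mpr ⟨a, hQ⟩, this, this⟩ hmeet
    · obtain ⟨Q, hQ, hQb⟩ := h.exists_mem_of_full hM hab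
      exact absurd ⟨Q, (h.config.cover Q).mpr ⟨a, hQ⟩, h.config.sub a Q hQ, hQb⟩ hmeet
  · obtain ⟨Q, hQ, hQM⟩ := h.exists_mem_of_full_of_notMem_range hMr hM a
    exact absurd ⟨Q, (h.config.cover Q).mpr ⟨a, hQ⟩, h.config.sub a Q hQ, hQM⟩ hmeet

/-- `L a` is itself one of the full lines and contributes `s` instead of `1`. -/
theorem sum_fullLines (h : StaircaseData X s Y L i₀ i₁ P A B H) {a : Fin s}
    (ha : (onLine X (L a)).card = s) :
    ((fullLines X L H).toList.map fun M => (onLine (onLine X (L a)) M).card).sum + 1 =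
      (fullLines X L H).card + s := by
  have hmem := h.mem_fullLines.mpr ha
  rw [Finset.sum_map_toList, ← Finset.add_sum_erase _ _ hmem]
  have h1 : onLine (onLine X (L a)) (L a) = onLine X (L a) := by
    ext Q
    simp only [mem_onLine]
    tauto
  have h2 : ∀ M ∈ (fullLines X L H).erase (L a), (onLine (onLine X (L a)) M).card = 1 := by
    intro M hM
    rw [Finset.mem_erase] at hM
    exact h.card_inter_full (Ne.symm hM.1) hmem hM.2
  rw [h1, ha, Finset.sum_congr rfl h2, Finset.sum_const, smul_eq_mul, mul_one,
    ← Finset.card_erase_add_one hmem]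
  omega

/-- After the full lines, the lines `L j` with `2 ≤ j` can be peeled off in decreasing order. -/
theorem defect_le_descending [Infinite K] (h : StaircaseData X s Y L i₀ i₁ P A B H) {m n : ℕ}
    (hm : s + 1 ≤ m) (hn : n + (s - 2) + (fullLines X L H).card + 1 = m * s) :
    defect X (peel (fun _ => m) (fullLines X L H).toList) (n + (s - 2)) ≤
      defect X (peel (fun _ => m)
        ((fullLines X L H).toList ++ ConfigData.descending L 2)) n := by
  have hs2 := h.two_le
  have hlen : (ConfigData.descending L 2).length = s - 2 := ConfigData.length_descending hs2
  rw [peel_append, ← hlen]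
  refine defect_le_peel _ fun l₁ M l₂ hl => ?_
  obtain ⟨a, ha, rfl, hnd, hl1, hmem⟩ := ConfigData.descending_split h.config.inj hl
  rw [← peel_append, hlen]
  have h1 := sum_peel_const (X := X) (L := L a) (l := (fullLines X L H).toList ++ l₁) (m := m)
    fun Q hQ => by
      have h2 := h.through_fullLines_le (mem_onLine.mp hQ).1
      have h3 := through_le_length l₁ Q
      rw [through_append]
      omega
  rw [List.map_append, List.sum_append] at h1
  have hw := h.card_add_missing a
  have hD := h.length_fullLines_le a
  have hC : l₁.length ≤ (l₁.map fun M => (onLine (onLine X (L a)) M).card).sum +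
      (ConfigData.missing Y L a).card := by
    refine ConfigData.length_le_add_missing hnd fun M hM he => ?_
    obtain ⟨j, hj, rfl⟩ := (hmem M).mp hM
    exact ⟨j, h.config.mem_missing_of_empty hj he, rfl⟩
  generalize (ConfigData.missing Y L a).card = w at *
  -- If `L a` is full, it has already been peeled once, which saves `s`. Otherwise each of its `w`
  -- missing points saves `m ≥ 3`, while at most `2 * w` is lost to peeled lines not meeting it in
  -- `X`.
  rcases Nat.eq_zero_or_pos w with rfl | hwpos
  · have h2 := h.sum_fullLines (a := a) (by omega)
    rw [add_zero] at hw
    rw [hw] at h1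
    omega
  · have h2 : m * (onLine X (L a)).card + m * w = m * s := by rw [← mul_add, hw]
    have h3 : 3 * w ≤ m * w := Nat.mul_le_mul_right _ (by omega)
    omega

theorem two_le_card_filter {S : Finset (Line K)} {M N : Line K} (hMN : M ≠ N) (hM : M ∈ S)
    (hN : N ∈ S) {Q : Plane K} (hQM : Q ∈ M.points) (hQN : Q ∈ N.points) :
    2 ≤ (S.filter fun M => Q ∈ M.points).card := by
  rw [← Finset.card_pair hMN]
  refine Finset.card_le_card ?_
  intro R hR
  rw [Finset.mem_insert, Finset.mem_singleton] at hR
  rcases hR with rfl | rfl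
  · exact Finset.mem_filter.mpr ⟨hM, hQM⟩
  · exact Finset.mem_filter.mpr ⟨hN, hQN⟩

/-- Each of the points `P`, `A`, `B` lies on two of the lines. -/
theorem two_le_card_allLines (h : StaircaseData X s Y L i₀ i₁ P A B H) {Q : Plane K} {j : Fin s}
    (hQ : Q ∈ Y j) (hj : (j : ℕ) < 2) :
    2 ≤ ((allLines L H).filter fun M => Q ∈ M.points).card := by
  have h01 : L i₀ ≠ L i₁ := fun e => h.index_ne (h.config.inj e)
  have hH : ∀ a, L a ≠ H := fun a e => h.H_notMem_range ⟨a, e⟩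
  rcases h.eq_or_eq_or_eq hQ hj with rfl | rfl | rfl
  · exact two_le_card_filter (hH i₀) (L_mem_allLines i₀) H_mem_allLines
      (h.config.sub i₀ _ h.P_mem_Y) h.P_mem
  · exact two_le_card_filter h01 (L_mem_allLines i₀) (L_mem_allLines i₁) h.A_mem
      (h.config.sub i₁ _ h.A_mem_Y)
  · exact two_le_card_filter (hH i₁) (L_mem_allLines i₁) H_mem_allLines
      (h.config.sub i₁ _ h.B_mem_Y) h.B_mem

theorem through_fullLines_add (Q : Plane K) :
    through (fullLines X L H).toList Q +
      through (allLines L H \ fullLines X L H).toList Q =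
        ((allLines L H).filter fun M => Q ∈ M.points).card := by
  rw [ConfigData.through_toList, ConfigData.through_toList, ← Finset.card_union_of_disjoint,
    ← Finset.filter_union, Finset.union_sdiff_of_subset]
  · exact Finset.filter_subset _ _
  · exact Finset.disjoint_filter_filter Finset.disjoint_sdiff

/-- The remaining lines can be peeled off in any order. -/
theorem defect_le_remaining [Infinite K] (h : StaircaseData X s Y L i₀ i₁ P A B H) {m n : ℕ}
    (hm : s + 1 ≤ m)
    (hn : n + (allLines L H \ fullLines X L H).card + (s - 2) + (fullLines X L H).card + 1 =
      m * s) :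
    defect X (peel (fun _ => m) ((fullLines X L H).toList ++ ConfigData.descending L 2))
      (n + (allLines L H \ fullLines X L H).card) ≤
      defect X (peel (fun _ => m) ((fullLines X L H).toList ++ ConfigData.descending L 2 ++
        (allLines L H \ fullLines X L H).toList)) n := by
  have hs2 := h.two_le
  rw [peel_append _ (_ ++ _), ← Finset.length_toList]
  refine defect_le_peel _ fun l₁ M l₂ hl => ?_
  have hlen := congrArg List.length hl
  have hsub : fullLines X L H ⊆ allLines L H := Finset.filter_subset _ _
  have hcard := Finset.card_sdiff_add_card_eq_card hsub
  rw [h.card_allLines] at hcard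
  simp only [List.length_append, List.length_cons, Finset.length_toList] at hlen
  rw [← peel_append, Finset.length_toList]
  have hM : M ∈ allLines L H \ fullLines X L H := by
    rw [← Finset.mem_toList, hl]
    simp
  have hMc : (onLine X M).card ≤ s - 1 := by
    have h1 := h.card_le M
    have h2 : (onLine X M).card ≠ s := fun e => (Finset.mem_sdiff.mp hM).2 (h.mem_fullLines.mpr e)
    omega
  set T := (fullLines X L H).toList ++ ConfigData.descending L 2 ++ l₁ with hT
  -- Points of `M` still carrying full multiplicity `m`; they can only be among `P`, `A`, `B`.
  set U := (onLine X M).filter fun Q => through T Q = 0 with hU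
  have hUmem : ∀ Q ∈ U, ∃ j : Fin s, Q ∈ Y j ∧ (j : ℕ) < 2 := by
    intro Q hQ
    rw [hU, Finset.mem_filter, mem_onLine] at hQ
    obtain ⟨j, hj⟩ := (h.config.cover Q).mp hQ.1.1
    refine ⟨j, hj, ?_⟩
    by_contra h2
    have := through_pos (ConfigData.mem_descending.mpr ⟨j, not_lt.mp h2, rfl⟩)
      (h.config.sub j Q hj)
    have h3 := hQ.2
    rw [hT, through_append, through_append] at h3
    omega
  have hsum : ∑ Q ∈ onLine X M, peel (fun _ => m) T Q ≤ (m - 1) * (onLine X M).card + U.card := by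
    rw [hU, Finset.card_filter, mul_comm, ← smul_eq_mul, ← Finset.sum_const,
      ← Finset.sum_add_distrib]
    refine Finset.sum_le_sum fun Q _ => ?_
    rw [peel]
    split_ifs <;> omega
  have hmul : (m - 1) * (onLine X M).card ≤ (m - 1) * (s - 1) := Nat.mul_le_mul_left _ hMc
  have hms : (m - 1) * (s - 1) + m + s = m * s + 1 := by
    obtain ⟨m', rfl⟩ : ∃ m', m = m' + 1 := ⟨m - 1, by omega⟩
    obtain ⟨s', rfl⟩ : ∃ s', s = s' + 1 := ⟨s - 1, by omega⟩
    simp only [Nat.add_sub_cancel]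
    ring
  -- What is needed is `U.card + l₁.length + (fullLines X L H).card ≤ m`. When `M` is the last line,
  -- `P`, `A` and `B` have each met another peeled line, so `U` is empty. Before that, at most `s -
  -- 1` lines are gone, and `U.card ≤ 2` because `P`, `A`, `B` are not collinear; this uses all of
  -- `s + 1 ≤ m`.
  rcases l₂ with _ | ⟨N, l₂⟩
  · have hU0 : U = ∅ := by
      rw [Finset.eq_empty_iff_forall_notMem]
      intro Q hQ
      obtain ⟨j, hj, hj2⟩ := hUmem Q hQ
      have h1 := h.two_le_card_allLines hj hj2
      rw [← through_fullLines_add (X := X), hl, through_append] at h1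
      have h2 : through [M] Q ≤ 1 := through_le_length [M] Q
      rw [hU, Finset.mem_filter, hT, through_append, through_append] at hQ
      omega
    rw [hU0, Finset.card_empty] at hsum
    simp only [List.length_nil] at hlen
    omega
  · have hUc : U.card ≤ 2 := by
      have hss : U ⊂ {P, A, B} := by
        refine Finset.ssubset_iff_subset_ne.mpr ⟨fun Q hQ => ?_, fun e => ?_⟩
        · obtain ⟨j, hj, hj2⟩ := hUmem Q hQ
          simpa using h.eq_or_eq_or_eq hj hj2
        · have hon : ∀ Q ∈ U, Q ∈ M.points := fun Q hQ =>
            (mem_onLine.mp (Finset.mem_filter.mp hQ).1).2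
          have hP := hon P (by rw [e]; simp)
          have hA := hon A (by rw [e]; simp)
          have hB := hon B (by rw [e]; simp)
          apply h.B_notMem
          rwa [line_eq_of_mem h.P_ne_A (h.config.sub i₀ P h.P_mem_Y) h.A_mem hP hA]
      have h1 := Finset.card_lt_card hss
      have h2 : ({P, A, B} : Finset (Plane K)).card ≤ 3 := Finset.card_le_three
      omega
    simp only [List.length_cons] at hlen
    omega

/-- The lines with the maximal number of points in type `(1, 2, …, s)`. -/
theorem exists_full [Infinite K] (h : StaircaseData X s Y L i₀ i₁ P A B H) {m : ℕ}
    (hm : s + 1 ≤ m) :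
    ∃ D : Finset (Line K), (∀ M, M ∈ D ↔ (onLine X M).card = s) ∧ D.card ≤ m ∧
      ∃ n, n + D.card + 1 = m * s ∧ defect X (peel (fun _ => m) D.toList) n ≤ 0 := by
  have hs2 := h.two_le
  have hsub : fullLines X L H ⊆ allLines L H := Finset.filter_subset _ _
  have hcard := Finset.card_sdiff_add_card_eq_card hsub
  rw [h.card_allLines] at hcard
  have hms : (m - 2) * s + 2 * s = m * s := by
    rw [← Nat.add_mul, Nat.sub_add_cancel (by omega)]
  -- In all, `2 * s - 1` lines are peeled starting from `m * s - 1`, which leaves `(m - 2) * s`.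
  -- Every point is met twice: those of `Y j` with `2 ≤ j` because `L j` is peeled twice, and `P`,
  -- `A`, `B` by two of `L i₀`, `L i₁`, `H`.
  refine ⟨fullLines X L H, fun M => h.mem_fullLines, by omega,
    (m - 2) * s + (allLines L H \ fullLines X L H).card + (s - 2), by omega, ?_⟩
  refine (h.defect_le_descending hm (by omega)).trans
    ((h.defect_le_remaining hm (by omega)).trans
      (h.config.defect_nonpos h.pos (fun _ => Nat.succ_pos _) (m - 2) _ _ (fun Q hQ => ?_) ?_))
  · obtain ⟨j, hj⟩ := (h.config.cover Q).mp hQ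
    have h1 := through_fullLines_add (X := X) (L := L) (H := H) Q
    rw [peel, through_append, through_append]
    by_cases hj2 : (j : ℕ) < 2
    · have := h.two_le_card_allLines hj hj2
      omega
    · have h2 := through_pos (ConfigData.mem_descending.mpr ⟨j, not_lt.mp hj2, rfl⟩)
        (h.config.sub j Q hj)
      have h3 : 0 < ((allLines L H).filter fun M => Q ∈ M.points).card :=
        Finset.card_pos.mpr ⟨L j, Finset.mem_filter.mpr ⟨L_mem_allLines j, h.config.sub j Q hj⟩⟩
      omega
  · exact (congrArg ((m - 2) * ·) (top_eq h.pos)).le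

end StaircaseData

/-! ### Normalization and assembly -/

theorem mem_linesWithExactly {X : Finset (Plane K)} {n : ℕ} {M : Line K} :
    M ∈ linesWithExactly X n ↔ (onLine X M).card = n := by
  have : (X : Set (Plane K)) ∩ M.points = (onLine X M : Set (Plane K)) := by
    ext P
    simp [mem_onLine]
  rw [linesWithExactly, Set.mem_ofPred_eq, this, Set.ncard_coe_finset]

theorem IsKConfiguration.exists_configData {X : Finset (Plane K)} {s : ℕ} {d : Fin s → ℕ}
    (h : IsKConfiguration X d) : ∃ Y L, ConfigData X d Y L := by
  obtain ⟨-, hmono, Y, L, hinj, hcov, hY, hsep⟩ := h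
  refine ⟨Y, L, hmono, hinj, fun P => ?_, fun i => (hY i).1, fun i P hP => (hY i).2 hP, hsep⟩
  rw [← Finset.mem_coe, hcov]
  simp

namespace ConfigData

variable {X : Finset (Plane K)} {s : ℕ} {d : Fin s → ℕ} {Y : Fin s → Finset (Plane K)}
  {L : Fin s → Line K}

/-- A configuration of type `(1, 2, …, s)` with `2 ≤ s` can be put in standard form. -/
theorem exists_staircaseData (h : ConfigData X (fun i : Fin s => (i : ℕ) + 1) Y L) (hs : 2 ≤ s) :
    ∃ L' i₀ i₁ P A B H, StaircaseData X s Y L' i₀ i₁ P A B H := by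
  set i₀ : Fin s := ⟨0, by omega⟩ with hi₀
  set i₁ : Fin s := ⟨1, by omega⟩ with hi₁
  have h01 : i₀ ≠ i₁ := fun e => by simpa [hi₀, hi₁] using congrArg Fin.val e
  obtain ⟨P, hP⟩ := Finset.card_eq_one.mp (h.card i₀)
  obtain ⟨A, B, hAB, hY⟩ := Finset.card_eq_two.mp (h.card i₁)
  have hPY : P ∈ Y i₀ := by simp [hP]
  have hAY : A ∈ Y i₁ := by simp [hY]
  have hBY : B ∈ Y i₁ := by simp [hY]
  have hPA : P ≠ A := fun e => h01 (h.index_unique hPY (e ▸ hAY))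
  have hPB : P ≠ B := fun e => h01 (h.index_unique hPY (e ▸ hBY))
  obtain ⟨M, hPM, hAM, -⟩ := exists_line_through hPA
  obtain ⟨H, hPH, hBH, -⟩ := exists_line_through hPB
  have hpos : ∀ i, i ≠ i₀ → i₀ < i := fun i hi =>
    lt_of_le_of_ne (Fin.le_def.mpr (Nat.zero_le _)) (Ne.symm hi)
  have hMne : ∀ i, i ≠ i₀ → M ≠ L i := by
    rintro i hi rfl
    exact h.sep i i₀ (hpos i hi) P hPY hPM
  -- The first line may be any line through `P`: separation imposes nothing on it, since no index is
  -- smaller. Replacing it by the join of `P` and `A` leaves only one possible extra full line.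
  refine ⟨Function.update L i₀ M, i₀, i₁, P, A, B, H, ⟨h.mono, ?_, h.cover, h.card, ?_, ?_⟩,
    rfl, rfl, hP, hY, hAB, by simpa using hAM, hPH, hBH⟩
  · intro i j hij
    by_cases hi : i = i₀ <;> by_cases hj : j = i₀
    · rw [hi, hj]
    · subst hi
      rw [Function.update_self, Function.update_of_ne hj] at hij
      exact absurd hij (hMne j hj)
    · subst hj
      rw [Function.update_self, Function.update_of_ne hi] at hij
      exact absurd hij.symm (hMne i hi)
    · rw [Function.update_of_ne hi, Function.update_of_ne hj] at hij
      exact h.inj hij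
  · intro i Q hQ
    by_cases hi : i = i₀
    · subst hi
      rw [hP, Finset.mem_singleton] at hQ
      rw [Function.update_self, hQ]
      exact hPM
    · rw [Function.update_of_ne hi]
      exact h.sub i Q hQ
  · intro i j hji Q hQ
    have hi : i ≠ i₀ := by
      rintro rfl
      exact absurd (Fin.lt_def.mp hji) (Nat.not_lt_zero _)
    rw [Function.update_of_ne hi]
    exact h.sep i j hji Q hQ

/-- The lines with the maximal number of points form a finite set, and what remains after peeling
them off imposes independent conditions. -/
theorem exists_full [Infinite K] (h : ConfigData X d Y L) (hs : 0 < s) (hd : ∀ i, 1 ≤ d i)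
    (hd1 : List.ofFn d ≠ [1]) {m : ℕ} (hm : s + 1 ≤ m) :
    ∃ D : Finset (Line K),
      (∀ M, M ∈ D ↔ (onLine X M).card = d ⟨s - 1, Nat.sub_lt hs Nat.one_pos⟩) ∧ D.card ≤ m ∧
      ∃ n, n + D.card + 1 = m * d ⟨s - 1, Nat.sub_lt hs Nat.one_pos⟩ ∧
        defect X (peel (fun _ => m) D.toList) n ≤ 0 := by
  rcases (h.le_top hs hd).lt_or_eq with hlt | heq
  · exact h.exists_full_of_lt hs hd hlt hm
  · have hdi : d = fun i : Fin s => (i : ℕ) + 1 := by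
      ext i
      have h1 := h.add_le_top hs i
      have h2 := strictMono_add_le h.mono ⟨0, hs⟩ i (Fin.le_def.mpr (Nat.zero_le _))
      have h3 := hd ⟨0, hs⟩
      simp only at h2
      omega
    have hs2 : 2 ≤ s := by
      by_contra hlt
      obtain rfl : s = 1 := by omega
      exact hd1 (by simp [hdi])
    rw [← heq]
    subst hdi
    obtain ⟨L', i₀, i₁, P, A, B, H, h'⟩ := h.exists_staircaseData hs2
    exact h'.exists_full hm

end ConfigData

theorem firstDifference_eq (I : Ideal (MvPolynomial (Fin 3) K)) (t : ℕ) :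
    firstDifference (hilbertFunction I) t = shiftedHilbert I (t + 1) - shiftedHilbert I t := by
  rcases t with _ | t <;> simp [firstDifference, shiftedHilbert]

end KConf

theorem mainTheorem8 {K : Type*} [Field K] [IsAlgClosed K] (X : Finset (KConf.Plane K))
    (s : ℕ) (hs : 0 < s) (d : Fin s → ℕ) (hX : KConf.IsKConfiguration X d)
    (hd : List.ofFn d ≠ [1]) (m : ℕ) (hm : s + 1 ≤ m) :
    (KConf.linesWithExactly X (d ⟨s - 1, Nat.sub_lt hs Nat.one_pos⟩)).Finite ∧
      KConf.IsLastNonzeroValue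
        (KConf.firstDifference (KConf.hilbertFunction (KConf.fatIdeal m X)))
        ((KConf.linesWithExactly X (d ⟨s - 1, Nat.sub_lt hs Nat.one_pos⟩)).ncard : ℤ) := by
  have : Infinite K := IsAlgClosed.instInfinite
  have hd1 := hX.1
  obtain ⟨Y, L, h⟩ := hX.exists_configData
  obtain ⟨D, hD, hDm, n, hn, hdef⟩ := h.exists_full hs hd1 hd hm
  have hlines : KConf.linesWithExactly X (d ⟨s - 1, Nat.sub_lt hs Nat.one_pos⟩) = D := by
    ext M
    rw [KConf.mem_linesWithExactly, Finset.mem_coe, hD]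
  have hpos : 0 < D.card :=
    Finset.card_pos.mpr ⟨_, (hD _).mpr (h.card_onLine_last hs hd1)⟩
  have hfull := h.defect_eq_of_full hs hd1 D.nodup_toList
    (fun M hM => (hD M).mp (Finset.mem_toList.mp hM)) (m := m) (n := n)
    (by rwa [Finset.length_toList]) (by rwa [Finset.length_toList])
  rw [Finset.length_toList, le_antisymm hdef (KConf.defect_nonneg _ _ _), zero_add] at hfull
  have hreg : ∀ k, n + D.card + 1 ≤ k → KConf.defect X (fun _ => m) k = 0 := fun k hk =>
    le_antisymm (h.defect_nonpos hs hd1 m k _ (fun _ _ => le_rfl) (by omega))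
      (KConf.defect_nonneg _ _ _)
  have hdiff : ∀ t, KConf.firstDifference (KConf.hilbertFunction (KConf.fatIdeal m X)) t =
      KConf.defect X (fun _ => m) t - KConf.defect X (fun _ => m) (t + 1) := by
    intro t
    rw [KConf.firstDifference_eq, KConf.defect, KConf.defect]
    change KConf.shiftedHilbert (KConf.multIdeal X fun _ => m) (t + 1) -
      KConf.shiftedHilbert (KConf.multIdeal X fun _ => m) t = _
    ring
  rw [hlines, Set.ncard_coe_finset]
  -- The index `n + D.card` is `m * d_s - 1`: the defect is `D.card` there and zero afterwards.
  refine ⟨D.finite_toSet, n + D.card, ?_, by exact_mod_cast hpos.ne', fun u hu => ?_⟩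
  · rw [hdiff, hfull, hreg _ le_rfl, sub_zero]
  · rw [hdiff, hreg u hu, hreg (u + 1) (by omega), sub_zero]
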